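/- Let $p$ be a prime and let $K$ be a non-archimedean local field of characteristic $p$, with ring of integers $\mathcal{O}_K$, maximal ideal $\mathcal{P}_K=\pi\mathcal{O}_K$ ($\pi$ a fixed uniformizer) and residue field of cardinality $q$. For $x\in\mathcal{O}_K\setminus\{0\}$ write $x=ac(x)\,\pi^{\mathrm{ord}(x)}$ with $ac(x)\in\mathcal{O}_K^\times$, and put $|x|=q^{-\mathrm{ord}(x)}$, $|0|=0$. Let $\chi:\mathcal{O}_K^\times\to\mathbb{C}^\times$ be a continuous character, and put $\chi(ac(0))=0$. For $f\in\mathcal{O}_K[x,y]$ and $\mathrm{Re}(s)>0$ let $$Z_f(s,\chi)=\int_{\mathcal{O}_K^2}\chi(ac\,f(x,y))\,|f(x,y)|^s\,|dx\,dy|,$$ where $|dx\,dy|$ is the Haar measure giving $\mathcal{O}_K^2$ measure one. Let $d\ge 0$ and $m\ge 2$ be integers with $p\nmid m$, let $\mu_1\in\mathcal{O}_K^\times$, let $\mu_2\in\mathcal{O}_K$ with $\mu_2\neq 0$, and let $h_0\in\mathcal{O}_K[x]$ be either zero or such that every monomial occurring in $h_0$ has degree at least $d+1$. Put $$h(x,y)=\mu_1x^d+\mu_2y^m+\pi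 h_0(x),\qquad h_1(x,y)=\mu_1x^d+\mu_2y^m,$$ $\tilde d=d/\gcd(d,m)$ and $\tilde m=m/\gcd(d,m)$. Then: 1. If $d\le 1$, there is a polynomial $H_1\in\mathbb{C}[x]$ such that for all $s$ with $\mathrm{Re}(s)>0$ $$Z_h(s,\chi)=\frac{H_1(q^{-s})}{1-q^{-1-s}}.$$ 2. If $d\ge 2$, there is a polynomial $H_2\in\mathbb{C}[x]$ such that for all $s$ with $\mathrm{Re}(s)>0$ $$Z_h(s,\chi)=\frac{H_2(q^{-s})}{(1-q^{-1-s})(1-q^{-\tilde d-\tilde m-\tilde d\tilde m\gcd(d,m)s})}.$$ 3. If $d\ge 2$ and moreover $p\nmid d$ or $\chi$ is trivial on $1+\mathcal{P}_K$, then $Z_h(s,\chi)=Z_{h_1}(s,\chi)$ for all $s$ with $\mathrm{Re}(s)>0$. -/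

import Mathlib

open scoped ValuativeRel
open MeasureTheory

noncomputable section

namespace IgusaZeta

variable (K : Type*) [Field K] [ValuativeRel K] [TopologicalSpace K]
  [IsNonarchimedeanLocalField K]

/-- The cardinality `q` of the residue field of `K`. -/
def residueCard : ℕ := Nat.card 𝓀[K]

/-- The normalized Haar measure on the compact additive group of integers (total mass one). -/
def integerHaar [MeasurableSpace K] [BorelSpace K] : Measure 𝒪[K] :=
  Measure.addHaarMeasure (⊤ : TopologicalSpace.PositiveCompacts 𝒪[K])

/-- The Haar measure `|dx|` on `K ^ n`, normalized so that `𝒪 ^ n` has measure one, restricted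
to `𝒪 ^ n`; it is the product of the normalized Haar measures of the factors. -/
def integerHaarPow [MeasurableSpace K] [BorelSpace K] (n : ℕ) : Measure (Fin n → 𝒪[K]) :=
  Measure.pi fun _ => integerHaar K

variable {K}

/-- The absolute value `|x| = q ^ (- ord x)` of an integer `x` of `K`, with `|0| = 0`. -/
def absVal (x : 𝒪[K]) : ℝ :=
  open Classical in
  if x = 0 then 0
  else ((residueCard K : ℝ)⁻¹) ^ (IsDiscreteValuationRing.addVal 𝒪[K] x).toNat

/-- The angular component of an integer `x` of `K` with respect to the uniformizer `ϖ`: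
the unit `u` with `x = u * ϖ ^ ord x` if `x ≠ 0`, and `0` if `x = 0`. -/
def angularComponent (ϖ x : 𝒪[K]) : 𝒪[K] :=
  open Classical in
  if h : ∃ u : 𝒪[K]ˣ, ∃ k : ℕ, x = (u : 𝒪[K]) * ϖ ^ k then (h.choose : 𝒪[K]) else 0

/-- Igusa's local zeta function
`Z_f(s, χ) = ∫_{𝒪 ^ n} χ(ac f(x)) |f(x)| ^ s |dx|` (meant for `0 < re s`), where `χ` is extended
by `χ(0) = 0`. -/
def zeta [MeasurableSpace K] [BorelSpace K] {n : ℕ} (ϖ : 𝒪[K]) (χ : 𝒪[K]ˣ →* ℂˣ)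
    (f : MvPolynomial (Fin n) 𝒪[K]) (s : ℂ) : ℂ :=
  ∫ x : Fin n → 𝒪[K],
    MulChar.ofUnitHom χ (angularComponent ϖ (MvPolynomial.eval x f)) *
      (absVal (MvPolynomial.eval x f) : ℂ) ^ s ∂(integerHaarPow K n)

/-- The two-variable polynomial `μ₁ x ^ d + μ₂ y ^ m + ϖ h₀(x)`. -/
def hPoly (ϖ μ₁ μ₂ : 𝒪[K]) (d m : ℕ) (h₀ : Polynomial 𝒪[K]) : MvPolynomial (Fin 2) 𝒪[K] :=
  MvPolynomial.C μ₁ * MvPolynomial.X 0 ^ d + MvPolynomial.C μ₂ * MvPolynomial.X 1 ^ m +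
    MvPolynomial.C ϖ * Polynomial.aeval (MvPolynomial.X 0) h₀

/-- The two-variable polynomial `μ₁ x ^ d + μ₂ y ^ m`. -/
def h₁Poly (μ₁ μ₂ : 𝒪[K]) (d m : ℕ) : MvPolynomial (Fin 2) 𝒪[K] :=
  MvPolynomial.C μ₁ * MvPolynomial.X 0 ^ d + MvPolynomial.C μ₂ * MvPolynomial.X 1 ^ m

end IgusaZeta

end

/-! With `z = q ^ (-s)` the integrand is `weight ϖ χ z (h x y)`, where `weight` sends `u * ϖ ^ k` to
`χ u * z ^ k`: multiplicative, and continuous for `‖z‖ < 1`. Since `h₀` starts in degree `d + 1`, `h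
= μ₁ x ^ d v(x) + μ₂ y ^ m` with `v(x) = 1 + ϖ x e(x)`. As `p ∤ m`, Hensel makes `v(x)` an `m`-th
power, and rescaling `y` by the root pulls it out of the inner integral
(`integral_weight_mul_add_mul_pow`). So `Z_h` is the integral of `ψ(x) * weight(h₁)` with `ψ = χ ∘
v`, and `ψ = 1` near `0`.

Let `a = m / gcd(d, m)` and `b = d / gcd(d, m)`, so `d a = m b` and `h₁(ϖ ^ a x, ϖ ^ b y) = ϖ ^ (d
a) h₁(x, y)`. The box `ϖ ^ a R × ϖ ^ b R` contributes `q ^ (-(a + b)) z ^ (d a)` times the same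
integral with `ψ(ϖ ^ a x)`. Off the box, `h₁` and `μ₂ y ^ m` are not both divisible by a certain `ϖ
^ M`. There the map `T` of `exists_shift` moves the value of `h₁` by any `τ ∈ ϖ ^ M R` while
preserving measure, so values in `ϖ ^ M R` are equidistributed and the contribution is a polynomial
over `1 - z / q` (`exists_polynomial_integral_add_mul_pow`). Finitely many rescalings turn `ψ` into
`1`; the recursion then closes on itself and yields the second factor
(`exists_polynomial_integral_mul_weight`).

For `d = 0` no box is needed; for `d = 1` the polynomial is a measure-preserving function of `x`. In
the third claim either `ψ = 1`, or a `d`-th root of `v` is absorbed into `x`. -/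

open Filter Topology

namespace IgusaZeta

/-! ### Balls and finite quotients in a discrete valuation ring. -/

section Algebra

variable {R : Type*} [CommRing R]

lemma setOf_dvd_eq_range (a : R) : {x : R | a ∣ x} = Set.range (fun y => a * y) := by
  ext x
  exact ⟨fun ⟨y, hy⟩ => ⟨y, hy.symm⟩, fun ⟨y, hy⟩ => ⟨y, hy.symm⟩⟩

lemma coe_span_singleton_toAddSubgroup (a : R) :
    ((Ideal.span {a}).toAddSubgroup : Set R) = {x | a ∣ x} := by
  ext x
  simp [Ideal.mem_span_singleton]

lemma isPiSystem_balls (ϖ : R) :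
    IsPiSystem (insert ∅ (⋃ n : ℕ, Set.range fun a : R => {x : R | ϖ ^ n ∣ x - a})) := by
  have key : ∀ n k : ℕ, ∀ a b : R, n ≤ k →
      ({x : R | ϖ ^ n ∣ x - a} ∩ {x : R | ϖ ^ k ∣ x - b}).Nonempty →
      {x : R | ϖ ^ n ∣ x - a} ∩ {x : R | ϖ ^ k ∣ x - b} = {x : R | ϖ ^ k ∣ x - b} := by
    rintro n k a b hnk ⟨z, hza, hzb⟩
    refine Set.inter_eq_right.mpr fun x (hx : ϖ ^ k ∣ x - b) => ?_
    have h := dvd_add (dvd_sub ((pow_dvd_pow ϖ hnk).trans hx) ((pow_dvd_pow ϖ hnk).trans hzb)) hza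
    simpa using h
  rintro s hs t ht hst
  rcases hs with rfl | hs
  · simp at hst
  rcases ht with rfl | ht
  · simp at hst
  simp only [Set.mem_iUnion, Set.mem_range] at hs ht
  obtain ⟨n, a, rfl⟩ := hs
  obtain ⟨k, b, rfl⟩ := ht
  right
  simp only [Set.mem_iUnion, Set.mem_range]
  rcases le_total n k with h | h
  · exact ⟨k, b, (key n k a b h hst).symm⟩
  · rw [Set.inter_comm] at hst ⊢
    exact ⟨n, a, (key k n b a h hst).symm⟩

variable [IsDomain R] [IsDiscreteValuationRing R]

lemma eq_zero_of_forall_pow_dvd {ϖ : R} (hϖ : Irreducible ϖ) {x : R} (h : ∀ n, ϖ ^ n ∣ x) :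
    x = 0 := by
  by_contra hx
  exact FiniteMultiplicity.not_iff_forall.mpr h
    (FiniteMultiplicity.of_not_isUnit hϖ.not_isUnit hx)

variable [Finite (IsLocalRing.ResidueField R)]

lemma finite_quotient_span_pow {ϖ : R} (hϖ : Irreducible ϖ) (n : ℕ) :
    Finite (R ⧸ Ideal.span {ϖ ^ n}) := by
  rw [← Ideal.span_singleton_pow, ← hϖ.maximalIdeal_eq]
  have : Finite (R ⧸ IsLocalRing.maximalIdeal R) :=
    inferInstanceAs (Finite (IsLocalRing.ResidueField R))
  exact Ideal.finite_quotient_pow (IsNoetherian.noetherian _) n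

lemma finiteIndex_span_pow {ϖ : R} (hϖ : Irreducible ϖ) (n : ℕ) :
    (Ideal.span {ϖ ^ n}).toAddSubgroup.FiniteIndex := by
  have := finite_quotient_span_pow hϖ n
  have : Finite (R ⧸ (Ideal.span {ϖ ^ n}).toAddSubgroup) := this
  exact AddSubgroup.finiteIndex_of_finite_quotient

end Algebra

/-! ### Topology and Haar measure of a compact discrete valuation ring. -/

section CompactRing

variable {R : Type*} [CommRing R] [TopologicalSpace R] [IsTopologicalRing R] [CompactSpace R]
  [T2Space R]

lemma isClosed_setOf_dvd (a : R) : IsClosed {x : R | a ∣ x} := by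
  rw [setOf_dvd_eq_range]
  exact (isCompact_range (by fun_prop)).isClosed

section

variable [IsDomain R] [MeasurableSpace R] [BorelSpace R]

/-- The pullback of `μ` along `y ↦ a * y` is translation invariant, hence a multiple of `μ`;
evaluating on the whole ring identifies the factor. -/
lemma setIntegral_dvd {a : R} (ha : a ≠ 0) (μ : Measure R) [μ.IsAddHaarMeasure]
    [IsProbabilityMeasure μ] (F : R → ℂ) :
    ∫ x in {x | a ∣ x}, F x ∂μ = μ.real {x | a ∣ x} * ∫ x, F (a * x) ∂μ := by
  have hrange := setOf_dvd_eq_range a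
  have hemb : MeasurableEmbedding (fun y : R => a * y) :=
    ((continuous_const_mul a).isClosedEmbedding (mul_right_injective₀ ha)).measurableEmbedding
  set ν := μ.comap (fun y : R => a * y) with hν
  have hνs : ∀ s, ν s = μ ((fun y => a * y) '' s) := fun s => hemb.comap_apply μ s
  have : IsFiniteMeasure ν := ⟨by rw [hνs]; exact measure_lt_top _ _⟩
  have : ν.IsAddLeftInvariant := ⟨fun g => by
    ext s hs
    rw [Measure.map_apply (measurable_const_add g) hs, hνs, hνs,
      ← measure_preimage_add μ (a * g) ((fun y => a * y) '' s)]
    congr 1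
    ext x
    simp only [Set.mem_image, Set.mem_preimage]
    constructor
    · rintro ⟨y, hy, rfl⟩
      exact ⟨g + y, hy, by ring⟩
    · rintro ⟨y, hy, h⟩
      exact ⟨y - g, by simpa using hy, by rw [mul_sub, h]; ring⟩⟩
  have hsmul := Measure.isAddInvariant_eq_smul_of_compactSpace ν μ
  have hc : ((ν.addHaarScalarFactor μ : NNReal) : ℝ) = μ.real {x | a ∣ x} := by
    have h1 : ν Set.univ = μ {x | a ∣ x} := by rw [hνs, Set.image_univ, hrange]
    rw [hsmul] at h1
    simp only [Measure.smul_apply, measure_univ] at h1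
    rw [measureReal_def, ← h1]
    simp [ENNReal.smul_def]
  have h2 : ∫ x in {x | a ∣ x}, F x ∂μ = ∫ x, F (a * x) ∂ν := by
    rw [hrange, ← hemb.map_comap μ, hemb.integral_map]
  rw [h2, hsmul, integral_smul_nnreal_measure, ← hc]
  rfl

end

variable [IsDomain R] [IsDiscreteValuationRing R] [Finite (IsLocalRing.ResidueField R)]

lemma isClopen_setOf_pow_dvd {ϖ : R} (hϖ : Irreducible ϖ) (n : ℕ) :
    IsClopen {x : R | ϖ ^ n ∣ x} := by
  refine ⟨isClosed_setOf_dvd _, ?_⟩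
  have := finiteIndex_span_pow hϖ n
  rw [← coe_span_singleton_toAddSubgroup]
  apply AddSubgroup.isOpen_of_isClosed_of_finiteIndex
  rw [coe_span_singleton_toAddSubgroup]
  exact isClosed_setOf_dvd _

lemma isClopen_setOf_pow_dvd_sub {ϖ : R} (hϖ : Irreducible ϖ) (n : ℕ) (a : R) :
    IsClopen {x : R | ϖ ^ n ∣ x - a} :=
  (isClopen_setOf_pow_dvd hϖ n).preimage (continuous_id.sub continuous_const)

/-- The balls are closed and nested with intersection `{a}`, so by compactness some ball lies in any
given neighbourhood. -/
lemma nhds_hasBasis_pow_dvd_sub {ϖ : R} (hϖ : Irreducible ϖ) (a : R) :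
    (𝓝 a).HasBasis (fun _ : ℕ => True) fun n => {x | ϖ ^ n ∣ x - a} := by
  refine ⟨fun U => ⟨fun hU => ?_, fun ⟨n, _, hn⟩ => ?_⟩⟩
  · obtain ⟨n, hn⟩ := exists_subset_nhds_of_compactSpace (U := U)
      (V := fun n : ℕ => {x : R | ϖ ^ n ∣ x - a})
      (directed_of_isDirected_le fun i j hij x hx => (pow_dvd_pow ϖ hij).trans hx)
      (fun n => (isClopen_setOf_pow_dvd_sub hϖ n a).1) (fun x hx => by
        have : x - a = 0 := eq_zero_of_forall_pow_dvd hϖ fun n => Set.mem_iInter.mp hx n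
        rwa [sub_eq_zero.mp this])
    exact ⟨n, trivial, hn⟩
  · exact mem_of_superset ((isClopen_setOf_pow_dvd_sub hϖ n a).2.mem_nhds (by simp)) hn

lemma isTopologicalBasis_balls {ϖ : R} (hϖ : Irreducible ϖ) : TopologicalSpace.IsTopologicalBasis
    (⋃ n : ℕ, Set.range fun a : R => {x : R | ϖ ^ n ∣ x - a}) := by
  refine TopologicalSpace.isTopologicalBasis_of_isOpen_of_nhds ?_ ?_
  · simp only [Set.mem_iUnion, Set.mem_range]
    rintro _ ⟨n, a, rfl⟩
    exact (isClopen_setOf_pow_dvd_sub hϖ n a).2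
  · intro a U ha hU
    obtain ⟨n, -, hn⟩ := (nhds_hasBasis_pow_dvd_sub hϖ a).mem_iff.mp (hU.mem_nhds ha)
    exact ⟨_, Set.mem_iUnion.mpr ⟨n, a, rfl⟩, by simp, hn⟩

lemma secondCountableTopology {ϖ : R} (hϖ : Irreducible ϖ) : SecondCountableTopology R := by
  have hb := isTopologicalBasis_balls hϖ
  refine hb.secondCountableTopology (Set.countable_iUnion fun n => ?_)
  have := finite_quotient_span_pow hϖ n
  refine Set.Finite.countable ((Set.finite_range fun b : R ⧸ Ideal.span {ϖ ^ n} =>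
    {x : R | Ideal.Quotient.mk _ x = b}).subset ?_)
  rintro _ ⟨a, rfl⟩
  refine ⟨Ideal.Quotient.mk _ a, ?_⟩
  ext x
  simp [Ideal.Quotient.eq, Ideal.mem_span_singleton]

variable [MeasurableSpace R] [BorelSpace R]

lemma borel_eq_generateFrom_balls {ϖ : R} (hϖ : Irreducible ϖ) :
    (inferInstance : MeasurableSpace R) = MeasurableSpace.generateFrom
      (insert ∅ (⋃ n : ℕ, Set.range fun a : R => {x : R | ϖ ^ n ∣ x - a})) := by
  have := secondCountableTopology hϖ
  have hb := isTopologicalBasis_balls hϖ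
  rw [MeasurableSpace.generateFrom_insert_empty, ← hb.borel_eq_generateFrom]
  exact BorelSpace.measurable_eq

/-- A self-map of a compact discrete valuation ring preserving the valuation of differences
preserves the Haar measure. -/
lemma measurePreserving_of_associated_sub {ϖ : R} (hϖ : Irreducible ϖ) (μ : Measure R)
    [μ.IsAddHaarMeasure] {φ : R → R} (hφ : ∀ x y, Associated (φ x - φ y) (x - y)) :
    MeasurePreserving φ μ μ := by
  have hdvd : ∀ n x y, ϖ ^ n ∣ φ x - φ y ↔ ϖ ^ n ∣ x - y := fun n x y => (hφ x y).dvd_iff_dvd_right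
  have hcont : Continuous φ := continuous_iff_continuousAt.mpr fun a =>
    ((nhds_hasBasis_pow_dvd_sub hϖ a).tendsto_iff (nhds_hasBasis_pow_dvd_sub hϖ (φ a))).mpr
      fun n _ => ⟨n, trivial, fun x hx => (hdvd n x a).mpr hx⟩
  refine ⟨hcont.measurable, ?_⟩
  symm
  refine ext_of_generate_finite _ (borel_eq_generateFrom_balls hϖ) (isPiSystem_balls ϖ) ?_ ?_
  · rintro s (rfl | hs)
    · simp
    simp only [Set.mem_iUnion, Set.mem_range] at hs
    obtain ⟨n, a, rfl⟩ := hs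
    rw [Measure.map_apply hcont.measurable (isClopen_setOf_pow_dvd_sub hϖ n a).2.measurableSet]
    have hfin := finite_quotient_span_pow hϖ n
    have hmk : ∀ x y : R, Ideal.Quotient.mk (Ideal.span {ϖ ^ n}) x = Ideal.Quotient.mk _ y ↔
        ϖ ^ n ∣ x - y := fun x y => by simp [Ideal.Quotient.eq, Ideal.mem_span_singleton]
    -- `φ` induces an injective, hence surjective, self-map of the finite quotient. So the preimage
    -- of a ball is nonempty, and therefore a ball of the same radius.
    let ψ : R ⧸ Ideal.span {ϖ ^ n} → R ⧸ Ideal.span {ϖ ^ n} := fun b =>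
      Ideal.Quotient.mk _ (φ (Function.surjInv Ideal.Quotient.mk_surjective b))
    have hψ : Function.Injective ψ := by
      intro b c hbc
      have := (hmk _ _).mpr ((hdvd n _ _).mp ((hmk _ _).mp hbc))
      rwa [Function.surjInv_eq Ideal.Quotient.mk_surjective,
        Function.surjInv_eq Ideal.Quotient.mk_surjective] at this
    obtain ⟨c, hc⟩ := Finite.surjective_of_injective hψ (Ideal.Quotient.mk _ a)
    set b := Function.surjInv Ideal.Quotient.mk_surjective c
    have hb : ϖ ^ n ∣ φ b - a := (hmk _ _).mp hc
    have hpre : φ ⁻¹' {x | ϖ ^ n ∣ x - a} = (fun x => (a - b) + x) ⁻¹' {x | ϖ ^ n ∣ x - a} := by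
      ext x
      have h1 : ϖ ^ n ∣ φ x - a ↔ ϖ ^ n ∣ φ x - φ b := by
        rw [← sub_add_sub_cancel (φ x) (φ b) a, dvd_add_left hb]
      simp only [Set.mem_preimage, Set.mem_ofPred_eq, h1, hdvd]
      congr! 1
      ring
    rw [hpre, measure_preimage_add]
  · rw [Measure.map_apply hcont.measurable .univ, Set.preimage_univ]

lemma integral_comp_of_associated_sub {ϖ : R} (hϖ : Irreducible ϖ) (μ : Measure R)
    [μ.IsAddHaarMeasure] {φ : R → R} (hφ : ∀ x y, Associated (φ x - φ y) (x - y))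
    {F : R → ℂ} (hF : Continuous F) : ∫ x, F (φ x) ∂μ = ∫ x, F x ∂μ := by
  have h := measurePreserving_of_associated_sub hϖ μ hφ
  have := secondCountableTopology hϖ
  rw [← integral_map h.measurable.aemeasurable hF.aestronglyMeasurable, h.map_eq]

lemma measureReal_dvd_irreducible {ϖ : R} (hϖ : Irreducible ϖ) (μ : Measure R)
    [μ.IsAddHaarMeasure] [IsProbabilityMeasure μ] :
    μ.real {x | ϖ ∣ x} = (Nat.card (IsLocalRing.ResidueField R) : ℝ)⁻¹ := by
  have := finiteIndex_span_pow hϖ 1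
  rw [pow_one] at this
  have hcard : (Ideal.span {ϖ}).toAddSubgroup.index = Nat.card (IsLocalRing.ResidueField R) := by
    rw [← hϖ.maximalIdeal_eq]
    rfl
  have h := AddSubgroup.index_mul_measure (Ideal.span {ϖ}).toAddSubgroup (by
    rw [coe_span_singleton_toAddSubgroup]; exact (isClosed_setOf_dvd _).measurableSet) μ
  rw [coe_span_singleton_toAddSubgroup, hcard, measure_univ] at h
  have h' := congrArg ENNReal.toReal h
  simp only [ENNReal.toReal_mul, ENNReal.toReal_natCast, ENNReal.toReal_one] at h'
  exact eq_inv_of_mul_eq_one_right h'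

lemma measureReal_pow_dvd {ϖ : R} (hϖ : Irreducible ϖ) (μ : Measure R)
    [μ.IsAddHaarMeasure] [IsProbabilityMeasure μ] (n : ℕ) :
    μ.real {x | ϖ ^ n ∣ x} = ((Nat.card (IsLocalRing.ResidueField R) : ℝ)⁻¹) ^ n := by
  induction n with
  | zero => simp
  | succ n ih =>
    have hmeas : ∀ k, MeasurableSet {x : R | ϖ ^ k ∣ x} := fun k =>
      (isClosed_setOf_dvd _).measurableSet
    have hsub : {x : R | ϖ ^ (n + 1) ∣ x} ⊆ {x | ϖ ∣ x} := fun x hx =>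
      (dvd_pow_self ϖ n.succ_ne_zero).trans hx
    have h := setIntegral_dvd hϖ.ne_zero μ ({x | ϖ ^ (n + 1) ∣ x}.indicator fun _ => 1)
    have h1 : ∀ x, ({x | ϖ ^ (n + 1) ∣ x}.indicator (fun _ => (1 : ℂ))) (ϖ * x) =
        {x | ϖ ^ n ∣ x}.indicator (fun _ => 1) x := fun x => by
      have h2 : ϖ ^ (n + 1) ∣ ϖ * x ↔ ϖ ^ n ∣ x := by
        rw [pow_succ', mul_dvd_mul_iff_left hϖ.ne_zero]
      by_cases h3 : ϖ ^ n ∣ x <;> simp [h2, h3]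
    simp_rw [h1] at h
    rw [setIntegral_indicator (hmeas _), integral_indicator (hmeas _),
      Set.inter_eq_right.mpr hsub] at h
    simp only [integral_const, measureReal_restrict_apply_univ, Complex.real_smul,
      mul_one] at h
    rw [measureReal_dvd_irreducible hϖ, ih] at h
    rw [pow_succ' (Nat.card (IsLocalRing.ResidueField R) : ℝ)⁻¹]
    exact_mod_cast h

end CompactRing

/-! ### The multiplicative integrand. -/

section Weight

variable {R : Type*} [CommRing R]

open Classical in
/-- The function `u * ϖ ^ k ↦ χ u * z ^ k` on a discrete valuation ring with uniformizer `ϖ`,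
extended by zero. -/
noncomputable def weight (ϖ : R) (χ : Rˣ →* ℂˣ) (z : ℂ) (t : R) : ℂ :=
  if h : ∃ u : Rˣ, ∃ k : ℕ, t = u * ϖ ^ k then χ h.choose * z ^ h.choose_spec.choose else 0

variable [IsDomain R] [IsDiscreteValuationRing R] {ϖ : R} (hϖ : Irreducible ϖ)
  (χ : Rˣ →* ℂˣ) (z : ℂ)

include hϖ

lemma weight_unit_mul_pow (u : Rˣ) (k : ℕ) : weight ϖ χ z (u * ϖ ^ k) = χ u * z ^ k := by
  have h : ∃ v : Rˣ, ∃ n : ℕ, (u * ϖ ^ k : R) = v * ϖ ^ n := ⟨u, k, rfl⟩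
  have hs := h.choose_spec.choose_spec
  have h1 := IsDiscreteValuationRing.unit_mul_pow_congr_unit hϖ u _ k _ hs
  have h2 := IsDiscreteValuationRing.unit_mul_pow_congr_pow hϖ hϖ u _ k _ hs
  rw [weight, dif_pos h]
  exact congrArg₂ (fun (v : Rˣ) (n : ℕ) => (χ v : ℂ) * z ^ n) h1.symm h2.symm

lemma weight_zero : weight ϖ χ z 0 = 0 := by
  rw [weight, dif_neg]
  rintro ⟨u, k, h⟩
  exact mul_ne_zero u.ne_zero (pow_ne_zero k hϖ.ne_zero) h.symm

lemma weight_unit (u : Rˣ) : weight ϖ χ z u = χ u := by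
  simpa using weight_unit_mul_pow hϖ χ z u 0

lemma weight_mul (a b : R) : weight ϖ χ z (a * b) = weight ϖ χ z a * weight ϖ χ z b := by
  rcases eq_or_ne a 0 with rfl | ha
  · simp [weight_zero hϖ]
  rcases eq_or_ne b 0 with rfl | hb
  · simp [weight_zero hϖ]
  obtain ⟨k, u, rfl⟩ := IsDiscreteValuationRing.eq_unit_mul_pow_irreducible ha hϖ
  obtain ⟨n, v, rfl⟩ := IsDiscreteValuationRing.eq_unit_mul_pow_irreducible hb hϖ
  have h : (u * ϖ ^ k * (v * ϖ ^ n) : R) = ((u * v : Rˣ) : R) * ϖ ^ (k + n) := by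
    push_cast; ring
  rw [h, weight_unit_mul_pow hϖ, weight_unit_mul_pow hϖ, weight_unit_mul_pow hϖ,
    map_mul, Units.val_mul, pow_add]
  ring

lemma weight_pow_mul (k : ℕ) (a : R) :
    weight ϖ χ z (ϖ ^ k * a) = z ^ k * weight ϖ χ z a := by
  rw [weight_mul hϖ, ← one_mul (ϖ ^ k), ← Units.val_one, weight_unit_mul_pow hϖ]
  simp

/-- On a fixed valuation `k` the parameter enters only through `z ^ k`; the auxiliary `w` expresses
the remaining factor, the value of `χ` at the angular component. -/
lemma weight_of_exact_dvd {k : ℕ} {t : R} (h1 : ϖ ^ k ∣ t) (h2 : ¬ ϖ ^ (k + 1) ∣ t) (w : ℂ)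
    (hw : w ≠ 0) : weight ϖ χ z t = z ^ k * ((w⁻¹) ^ k * weight ϖ χ w t) := by
  obtain ⟨a, rfl⟩ := h1
  have ha : IsUnit a := by
    by_contra ha
    rw [← mem_nonunits_iff, ← IsLocalRing.mem_maximalIdeal, hϖ.maximalIdeal_eq,
      Ideal.mem_span_singleton] at ha
    exact h2 (by rw [pow_succ]; exact mul_dvd_mul_left _ ha)
  obtain ⟨u, rfl⟩ := ha
  rw [weight_pow_mul hϖ, weight_pow_mul hϖ, weight_unit hϖ, weight_unit hϖ, ← mul_assoc (w⁻¹ ^ k),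
    ← mul_pow, inv_mul_cancel₀ hw, one_pow, one_mul]

lemma isUnit_one_add_mul (a : R) : IsUnit (1 + ϖ * a) := by
  have h : ϖ * a ∈ IsLocalRing.maximalIdeal R := by
    rw [hϖ.maximalIdeal_eq]; exact Ideal.mul_mem_right _ _ (Ideal.mem_span_singleton_self ϖ)
  rw [IsLocalRing.mem_maximalIdeal, mem_nonunits_iff] at h
  exact (IsLocalRing.isUnit_or_isUnit_of_isUnit_add (a := 1 + ϖ * a) (b := -(ϖ * a))
    (by simp)).resolve_right (by rwa [IsUnit.neg_iff])

end Weight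

/-- There are no small subgroups: `z ^ 2 - 1 = (z + 1)(z - 1)`, so near `1` each squaring multiplies
the distance to `1` by at least `3 / 2`. -/
lemma eq_one_of_forall_norm_pow_sub_one_le {z : ℂ} (h : ∀ n : ℕ, ‖z ^ n - 1‖ ≤ 1 / 2) :
    z = 1 := by
  by_contra hz
  have hpos : 0 < ‖z - 1‖ := norm_pos_iff.mpr (sub_ne_zero.mpr hz)
  have key : ∀ k : ℕ, (3 / 2 : ℝ) ^ k * ‖z - 1‖ ≤ ‖z ^ (2 ^ k) - 1‖ := by
    intro k
    induction k with
    | zero => simp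
    | succ k ih =>
      have h1 : z ^ (2 ^ (k + 1)) - 1 = (2 + (z ^ (2 ^ k) - 1)) * (z ^ (2 ^ k) - 1) := by
        rw [pow_succ, pow_mul]; ring
      have h2 : (3 / 2 : ℝ) ≤ ‖2 + (z ^ (2 ^ k) - 1)‖ := by
        have := norm_sub_le_norm_add (2 : ℂ) (z ^ (2 ^ k) - 1)
        have h3 := h (2 ^ k)
        simp only [Complex.norm_ofNat] at this
        linarith
      rw [h1, norm_mul, pow_succ', mul_assoc]
      gcongr
  obtain ⟨k, hk⟩ := pow_unbounded_of_one_lt (1 / ‖z - 1‖) (by norm_num : (1 : ℝ) < 3 / 2)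
  have h1 := (key k).trans (h _)
  rw [div_lt_iff₀ hpos] at hk
  linarith

lemma one_sub_natCast_inv_mul_ne_zero (n : ℕ) {z : ℂ} (hz : ‖z‖ < 1) :
    1 - (n : ℂ)⁻¹ * z ≠ 0 := by
  intro h0
  have h1 : ‖(n : ℂ)⁻¹ * z‖ = 1 := by rw [← sub_eq_zero.mp h0, norm_one]
  rw [norm_mul, norm_inv, Complex.norm_natCast] at h1
  have h2 : (n : ℝ)⁻¹ ≤ 1 := Nat.cast_inv_le_one n
  have h3 : (0 : ℝ) ≤ (n : ℝ)⁻¹ := by positivity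
  nlinarith [norm_nonneg z]

lemma integrable_of_continuous {X : Type*} [TopologicalSpace X] [CompactSpace X]
    [MeasurableSpace X] [OpensMeasurableSpace X] (μ : Measure X) [IsFiniteMeasureOnCompacts μ]
    {F : X → ℂ} (hF : Continuous F) : Integrable F μ :=
  hF.integrable_of_hasCompactSupport (HasCompactSupport.of_compactSpace F)

/-! ### Conductor of the character; continuity and integral of the weight. -/

section Topology

variable {R : Type*} [CommRing R] [TopologicalSpace R] [IsTopologicalRing R] [CompactSpace R]
  [T2Space R] [IsDomain R] [IsDiscreteValuationRing R] [Finite (IsLocalRing.ResidueField R)]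
  {ϖ : R} (hϖ : Irreducible ϖ) {χ : Rˣ →* ℂˣ} (hχ : Continuous χ)

include hϖ hχ

/-- A continuous character of the unit group is trivial on `1 + ϖ ^ c` for some `c`. -/
lemma exists_conductor : ∃ c : ℕ, ∀ u : Rˣ, ϖ ^ c ∣ (u : R) - 1 → χ u = 1 := by
  have hU : {u : Rˣ | ‖(χ u : ℂ) - 1‖ < 1 / 2} ∈ 𝓝 (1 : Rˣ) := by
    refine IsOpen.mem_nhds ?_ (by simp)
    exact isOpen_lt ((Units.continuous_val.comp hχ).sub continuous_const).norm continuous_const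
  -- The topology on units is induced by `u ↦ (u, u⁻¹)`, so the inverse has to be controlled as
  -- well.
  rw [Units.isInducing_embedProduct.nhds_eq_comap, mem_comap] at hU
  obtain ⟨t, ht, htU⟩ := hU
  rw [map_one, Prod.one_eq_mk, nhds_prod_eq, mem_prod_iff] at ht
  obtain ⟨a, ha, b, hb, hab⟩ := ht
  obtain ⟨n, -, hn⟩ := (nhds_hasBasis_pow_dvd_sub hϖ 1).mem_iff.mp ha
  obtain ⟨k, -, hk⟩ := (nhds_hasBasis_pow_dvd_sub hϖ 1).mem_iff.mp
    (MulOpposite.continuous_op.continuousAt.preimage_mem_nhds hb)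
  have hball : ∀ u : Rˣ, ϖ ^ (n + k) ∣ (u : R) - 1 → ‖(χ u : ℂ) - 1‖ < 1 / 2 := by
    intro u hu
    refine htU (hab ⟨hn ((pow_dvd_pow ϖ (n.le_add_right k)).trans hu), hk ?_⟩)
    have h1 : ((u⁻¹ : Rˣ) : R) - 1 = -((u⁻¹ : Rˣ) : R) * ((u : R) - 1) := by
      rw [mul_sub, neg_mul, Units.inv_mul]; ring
    change ϖ ^ k ∣ ((u⁻¹ : Rˣ) : R) - 1
    rw [h1]
    exact ((pow_dvd_pow ϖ (k.le_add_left n)).trans hu).mul_left _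
  -- All powers of `u` stay in the same ball around `1`, so all powers of `χ u` stay close to `1`.
  refine ⟨n + k, fun u hu => Units.ext (eq_one_of_forall_norm_pow_sub_one_le fun j => ?_)⟩
  rw [← Units.val_pow_eq_pow_val, ← map_pow]
  refine (hball _ ?_).le
  rw [Units.val_pow_eq_pow_val]
  exact hu.trans (by simpa using sub_dvd_pow_sub_pow (u : R) 1 j)

/-- Modulo the conductor the unit group is finite, so `χ u` is a root of unity. -/
lemma norm_char_eq_one (u : Rˣ) : ‖(χ u : ℂ)‖ = 1 := by
  obtain ⟨c, hc⟩ := exists_conductor hϖ hχ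
  have := finite_quotient_span_pow hϖ c
  let f := Units.map (Ideal.Quotient.mk (Ideal.span {ϖ ^ c})).toMonoidHom
  set N := Nat.card (R ⧸ Ideal.span {ϖ ^ c})ˣ
  have h1 : f (u ^ N) = 1 := by rw [map_pow, pow_card_eq_one']
  have h2 : ϖ ^ c ∣ ((u ^ N : Rˣ) : R) - 1 := by
    rw [← Ideal.mem_span_singleton, ← Ideal.Quotient.eq]
    have h3 := congrArg Units.val h1
    rwa [Units.coe_map, Units.val_one] at h3
  have h3 := hc _ h2
  rw [map_pow] at h3
  have h4 := congrArg (fun v : ℂˣ => ‖(v : ℂ)‖) h3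
  simp only [Units.val_pow_eq_pow_val, norm_pow, Units.val_one, norm_one] at h4
  exact (pow_eq_one_iff_of_nonneg (norm_nonneg _) Nat.card_pos.ne').mp h4

lemma norm_weight_le {z : ℂ} (hz : ‖z‖ < 1) {n : ℕ} {t : R} (ht : ϖ ^ n ∣ t) :
    ‖weight ϖ χ z t‖ ≤ ‖z‖ ^ n := by
  rcases eq_or_ne t 0 with rfl | h0
  · rw [weight_zero hϖ, norm_zero]; positivity
  obtain ⟨k, u, rfl⟩ := IsDiscreteValuationRing.eq_unit_mul_pow_irreducible h0 hϖ
  rw [weight_unit_mul_pow hϖ, norm_mul, norm_char_eq_one hϖ hχ, one_mul, norm_pow]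
  refine pow_le_pow_of_le_one (norm_nonneg _) hz.le ?_
  rw [mul_comm] at ht
  exact (pow_dvd_pow_iff hϖ.ne_zero hϖ.not_isUnit).mp (u.isUnit.dvd_mul_right.mp ht)

lemma continuous_weight {z : ℂ} (hz : ‖z‖ < 1) : Continuous (weight ϖ χ z) := by
  obtain ⟨c, hc⟩ := exists_conductor hϖ hχ
  refine continuous_iff_continuousAt.mpr fun t => ?_
  rcases eq_or_ne t 0 with rfl | ht
  · rw [ContinuousAt, weight_zero hϖ]
    refine ((nhds_hasBasis_pow_dvd_sub hϖ 0).tendsto_iff Metric.nhds_basis_closedBall).mpr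
      fun ε hε => ?_
    obtain ⟨n, hn⟩ := exists_pow_lt_of_lt_one hε hz
    refine ⟨n, trivial, fun x hx => ?_⟩
    rw [Set.mem_ofPred_eq, sub_zero] at hx
    rw [mem_closedBall_zero_iff]
    exact (norm_weight_le hϖ hχ hz hx).trans hn.le
  · obtain ⟨k, u, rfl⟩ := IsDiscreteValuationRing.eq_unit_mul_pow_irreducible ht hϖ
    refine ContinuousAt.congr (f := fun _ => weight ϖ χ z (u * ϖ ^ k)) continuousAt_const ?_
    -- In the exponent, `k` is the valuation of the point, `c` the conductor, and the extra `1`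
    -- makes the quotient a principal unit even when `c = 0`.
    filter_upwards [(nhds_hasBasis_pow_dvd_sub hϖ ((u : R) * ϖ ^ k)).mem_of_mem
      (i := c + 1 + k) trivial] with x hx
    obtain ⟨a, ha⟩ := hx
    obtain ⟨v, hv⟩ := isUnit_one_add_mul hϖ (ϖ ^ c * a * (u⁻¹ : Rˣ))
    have hx : x = u * ϖ ^ k * v := by
      rw [hv]
      linear_combination ha - (ϖ ^ (c + 1 + k) * a) * u.mul_inv
    rw [hx, weight_mul hϖ _ _ _ (v : R), weight_unit hϖ, hc v, Units.val_one, mul_one]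
    rw [hv]
    exact ⟨ϖ * a * (u⁻¹ : Rˣ), by ring⟩

variable [MeasurableSpace R] [BorelSpace R] (μ : Measure R) [μ.IsAddHaarMeasure]
  [IsProbabilityMeasure μ]

omit hχ in
lemma setIntegral_weight_pow_dvd (z : ℂ) (n : ℕ) :
    ∫ t in {t | ϖ ^ n ∣ t}, weight ϖ χ z t ∂μ =
      ((Nat.card (IsLocalRing.ResidueField R) : ℂ)⁻¹) ^ n * (z ^ n * ∫ t, weight ϖ χ z t ∂μ) := by
  rw [setIntegral_dvd (pow_ne_zero n hϖ.ne_zero), measureReal_pow_dvd hϖ]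
  simp_rw [weight_pow_mul hϖ]
  rw [integral_const_mul]
  push_cast
  rfl

/-- The weight at parameter `0` is `χ` on units and zero elsewhere. The integral over `ϖ R` is `z /
q` times the whole integral, which gives a linear equation to solve. -/
lemma integral_weight {z : ℂ} (hz : ‖z‖ < 1) :
    ∫ t, weight ϖ χ z t ∂μ = (∫ t, weight ϖ χ 0 t ∂μ) /
      (1 - (Nat.card (IsLocalRing.ResidueField R) : ℂ)⁻¹ * z) := by
  set q := Nat.card (IsLocalRing.ResidueField R) with hq
  have hdec : ∀ t, weight ϖ χ z t =
      weight ϖ χ 0 t + {t | ϖ ^ 1 ∣ t}.indicator (weight ϖ χ z) t := by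
    intro t
    by_cases ht : ϖ ^ 1 ∣ t
    · rw [Set.indicator_of_mem (by exact ht)]
      obtain ⟨a, rfl⟩ := ht
      simp only [weight_pow_mul hϖ]
      ring
    · rw [Set.indicator_of_notMem (by exact ht), add_zero]
      have h0 : ϖ ^ 0 ∣ t := by simp
      rw [← zero_add 1] at ht
      rw [weight_of_exact_dvd hϖ χ z h0 ht 1 one_ne_zero,
        weight_of_exact_dvd hϖ χ 0 h0 ht 1 one_ne_zero]
      simp
  have hI : ∀ {w : ℂ}, ‖w‖ < 1 → Integrable (weight ϖ χ w) μ := fun hw =>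
    integrable_of_continuous μ (continuous_weight hϖ hχ hw)
  have hmeas : MeasurableSet {t : R | ϖ ^ 1 ∣ t} := (isClosed_setOf_dvd _).measurableSet
  have h := integral_congr_ae (μ := μ) (.of_forall hdec)
  rw [integral_add (hI (by simp)) ((hI hz).indicator hmeas), integral_indicator hmeas,
    setIntegral_weight_pow_dvd hϖ] at h
  rw [eq_div_iff]
  · linear_combination h
  · exact one_sub_natCast_inv_mul_ne_zero q hz

end Topology

/-! ### Roots of principal units and the shift map. -/

section Roots

variable {R : Type*} [CommRing R] [IsDomain R] [IsDiscreteValuationRing R]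
  {ϖ : R} (hϖ : Irreducible ϖ)

include hϖ

lemma isUnit_of_dvd_sub {a b : R} (h : ϖ ∣ a - b) (hb : IsUnit b) : IsUnit a := by
  obtain ⟨c, hc⟩ := h
  obtain ⟨u, rfl⟩ := hb
  have h1 : a = u * (1 + ϖ * (c * (u⁻¹ : Rˣ))) := by
    linear_combination hc - ϖ * c * u.mul_inv
  rw [h1]
  exact u.isUnit.mul (isUnit_one_add_mul hϖ _)

lemma dvd_or_irreducible_mul_dvd (a b : R) : a ∣ b ∨ ϖ * b ∣ a := by
  rcases ValuationRing.dvd_total a b with h | ⟨c, rfl⟩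
  · exact .inl h
  by_cases hc : IsUnit c
  · exact .inl (hc.dvd_mul_right.mp (by obtain ⟨u, rfl⟩ := hc; simp))
  · rw [← mem_nonunits_iff, ← IsLocalRing.mem_maximalIdeal, hϖ.maximalIdeal_eq,
      Ideal.mem_span_singleton] at hc
    exact .inr (by rw [mul_comm]; exact mul_dvd_mul_left b hc)

/-- The cofactor `∑ a ^ i * b ^ (m - 1 - i)` is congruent to `m` modulo `ϖ`, hence a unit. -/
lemma associated_pow_sub_pow {m : ℕ} (hm : IsUnit (m : R)) {a b : R} (ha : ϖ ∣ a - 1)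
    (hb : ϖ ∣ b - 1) : Associated (a ^ m - b ^ m) (a - b) := by
  have h1 : ϖ ∣ (∑ i ∈ Finset.range m, a ^ i * b ^ (m - 1 - i)) - m := by
    have h2 : (m : R) = ∑ i ∈ Finset.range m, 1 := by simp
    rw [h2, ← Finset.sum_sub_distrib]
    refine Finset.dvd_sum fun i _ => ?_
    have h3 : ∀ j, ϖ ∣ a ^ j - 1 := fun j =>
      ha.trans (by simpa using sub_dvd_pow_sub_pow a 1 j)
    have h4 : ∀ j, ϖ ∣ b ^ j - 1 := fun j =>
      hb.trans (by simpa using sub_dvd_pow_sub_pow b 1 j)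
    have h5 : a ^ i * b ^ (m - 1 - i) - 1 =
        a ^ i * (b ^ (m - 1 - i) - 1) + (a ^ i - 1) := by ring
    rw [h5]
    exact dvd_add ((h4 _).mul_left _) (h3 _)
  obtain ⟨u, hu⟩ := isUnit_of_dvd_sub hϖ h1 hm
  refine Associated.symm ⟨u, ?_⟩
  rw [hu, (Commute.all a b).mul_geom_sum₂]

variable [IsAdicComplete (IsLocalRing.maximalIdeal R) R]

lemma exists_pow_eq_of_dvd_sub_one {m : ℕ} (hm : IsUnit (m : R)) {a : R} (ha : ϖ ∣ a - 1) :
    ∃ r : R, ϖ ∣ r - 1 ∧ r ^ m = a := by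
  have hm0 : m ≠ 0 := by rintro rfl; simp at hm
  have hder : (Polynomial.derivative (Polynomial.X ^ m - Polynomial.C a)).eval 1 = (m : R) := by
    rw [Polynomial.derivative_sub, Polynomial.derivative_X_pow, Polynomial.derivative_C]
    simp
  obtain ⟨r, hr, hr1⟩ := HenselianRing.is_henselian (I := IsLocalRing.maximalIdeal R)
    (Polynomial.X ^ m - Polynomial.C a) (Polynomial.monic_X_pow_sub_C a hm0) 1 (by
      rw [hϖ.maximalIdeal_eq, Ideal.mem_span_singleton]
      simpa using dvd_sub_comm.mp ha) (by
      rw [hder]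
      exact hm.map (Ideal.Quotient.mk (IsLocalRing.maximalIdeal R)))
  rw [hϖ.maximalIdeal_eq, Ideal.mem_span_singleton] at hr1
  refine ⟨r, hr1, ?_⟩
  simpa [Polynomial.IsRoot, sub_eq_zero] using hr

/-- Additive translation of `b * y ^ m` by a small `τ` is realized by a self-map of `R` preserving
the valuation of differences. -/
lemma exists_shift {m : ℕ} (hm : IsUnit (m : R)) {b : R} (hb : b ≠ 0) {M : ℕ} {τ : R}
    (hτ : ϖ ^ M ∣ τ) :
    ∃ T : R → R, (∀ x y, Associated (T x - T y) (x - y)) ∧ (∀ y, ∃ u : Rˣ, T y = u * y) ∧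
      (∀ y, ¬ ϖ ^ M ∣ b * y ^ m → b * T y ^ m = b * y ^ m + τ) ∧
      ∀ y, ϖ ^ M ∣ b * y ^ m → T y = y := by
  have hρ : ∀ y, ∃ ρ : R, ϖ ∣ ρ - 1 ∧ (¬ ϖ ^ M ∣ b * y ^ m → b * (y * ρ) ^ m = b * y ^ m + τ) ∧
      (ϖ ^ M ∣ b * y ^ m → ρ = 1) := by
    intro y
    by_cases hy : ϖ ^ M ∣ b * y ^ m
    · exact ⟨1, by simp, fun h => (h hy).elim, fun _ => rfl⟩
    -- Here `ϖ * (b * y ^ m)` divides `τ`, so adding `τ` multiplies `b * y ^ m` by the principal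
    -- unit `1 + ϖ * c`, which has an `m`-th root.
    · obtain ⟨c, hc⟩ := ((dvd_or_irreducible_mul_dvd hϖ _ _).resolve_left hy).trans hτ
      obtain ⟨ρ, h1, h2⟩ := exists_pow_eq_of_dvd_sub_one hϖ hm (a := 1 + ϖ * c) (by simp)
      exact ⟨ρ, h1, fun _ => by rw [mul_pow, h2, hc]; ring, fun h => (hy h).elim⟩
  choose ρ hρ1 hρ2 hρ3 using hρ
  refine ⟨fun y => y * ρ y, fun x y => ?_, fun y => ?_, hρ2, fun y hy => by simp [hρ3 y hy]⟩
  · rcases dvd_or_irreducible_mul_dvd hϖ (x - y) x with h | h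
    · obtain ⟨c, hc⟩ := h
      obtain ⟨e, he⟩ := hρ1 x
      obtain ⟨f, hf⟩ := hρ1 y
      obtain ⟨u, hu⟩ := isUnit_one_add_mul hϖ (c * (e - f) + f)
      refine Associated.symm ⟨u, ?_⟩
      rw [hu]
      linear_combination -x * he + y * hf - ϖ * (e - f) * hc
    -- Now `y` is `x` times the principal unit `1 - ϖ * β`, so both points fall under the same case.
    -- Cancelling the common `τ` compares two differences of `m`-th powers, and
    -- `associated_pow_sub_pow` removes the exponents.
    · obtain ⟨β, hβ⟩ := h
      have hβ1 : ϖ ∣ (1 - ϖ * β) - 1 := ⟨-β, by ring⟩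
      have hy : y = x * (1 - ϖ * β) := by linear_combination -hβ
      obtain ⟨v, hv⟩ := isUnit_of_dvd_sub hϖ hβ1 isUnit_one
      have hiff : ϖ ^ M ∣ b * y ^ m ↔ ϖ ^ M ∣ b * x ^ m := by
        rw [hy, ← hv, mul_pow, ← mul_assoc, ← Units.val_pow_eq_pow_val, Units.dvd_mul_right]
      by_cases hx : ϖ ^ M ∣ b * x ^ m
      · simp only [hρ3 x hx, hρ3 y (hiff.mpr hx), mul_one]
        rfl
      · have h1 := hρ2 x hx
        have h2 := hρ2 y (fun h => hx (hiff.mp h))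
        have hm0 : m ≠ 0 := by rintro rfl; simp at hm
        have hx0 : x ≠ 0 := by rintro rfl; simp [hm0] at hx
        have h3 : ρ x ^ m - ((1 - ϖ * β) * ρ y) ^ m = 1 ^ m - (1 - ϖ * β) ^ m := by
          refine mul_left_cancel₀ (mul_ne_zero hb (pow_ne_zero m hx0)) ?_
          rw [hy] at h2
          simp only [mul_pow, one_pow] at h1 h2 ⊢
          rw [← hy] at h2
          linear_combination h1 - h2
        have h4 : ϖ ∣ (1 - ϖ * β) * ρ y - 1 := by
          have : (1 - ϖ * β) * ρ y - 1 = (ρ y - 1) + ϖ * (-β * ρ y) := by ring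
          rw [this]
          exact dvd_add (hρ1 y) (dvd_mul_right _ _)
        have h5 := (associated_pow_sub_pow hϖ hm (hρ1 x) h4).symm.trans
          (h3 ▸ associated_pow_sub_pow hϖ hm (by simp) hβ1)
        have h6 := (Associated.refl x).mul_mul h5
        have h7 : x * ρ x - y * ρ y = x * (ρ x - (1 - ϖ * β) * ρ y) := by
          linear_combination -ρ y * hy
        have h8 : x - y = x * (1 - (1 - ϖ * β)) := by rw [mul_sub, ← hy, mul_one]
        simp only
        rw [h7, h8]
        exact h6
  · obtain ⟨v, hv⟩ := isUnit_of_dvd_sub hϖ (hρ1 y) isUnit_one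
    exact ⟨v, by rw [hv, mul_comm]⟩

end Roots

/-! ### Equidistribution of values away from the singular point. -/

section Submersion

variable {R : Type*} [CommRing R]

/-- The angular component character on the elements of valuation `k`, extended by zero. -/
noncomputable def layer (ϖ : R) (χ : Rˣ →* ℂˣ) (k : ℕ) : R → ℂ :=
  {t | ϖ ^ k ∣ t ∧ ¬ ϖ ^ (k + 1) ∣ t}.indicator fun t => 2 ^ k * weight ϖ χ (1 / 2) t

lemma weight_eq_sum_layer_add [IsDomain R] [IsDiscreteValuationRing R] {ϖ : R}
    (hϖ : Irreducible ϖ) (χ : Rˣ →* ℂˣ) (z : ℂ) (M : ℕ) (t : R) :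
    weight ϖ χ z t = ∑ k ∈ Finset.range M, z ^ k * layer ϖ χ k t +
      {t | ϖ ^ M ∣ t}.indicator (weight ϖ χ z) t := by
  induction M with
  | zero => simp
  | succ M ih =>
    rw [ih, Finset.sum_range_succ, add_assoc]
    congr 1
    by_cases h1 : ϖ ^ M ∣ t
    · by_cases h2 : ϖ ^ (M + 1) ∣ t
      · rw [layer, Set.indicator_of_mem (by exact h1), Set.indicator_of_notMem (by simp [h2]),
          Set.indicator_of_mem (by exact h2)]
        simp
      · rw [layer, Set.indicator_of_mem (by exact h1), Set.indicator_of_mem (by exact ⟨h1, h2⟩),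
          Set.indicator_of_notMem (by exact h2),
          weight_of_exact_dvd hϖ χ z h1 h2 (1 / 2) (by norm_num)]
        norm_num
    · have h2 : ¬ ϖ ^ (M + 1) ∣ t := fun h => h1 ((pow_dvd_pow ϖ M.le_succ).trans h)
      rw [layer, Set.indicator_of_notMem (by exact h1), Set.indicator_of_notMem (by simp [h1]),
        Set.indicator_of_notMem (by exact h2)]
      simp

lemma setIntegral_indicator_pow_dvd_add [TopologicalSpace R] [IsTopologicalRing R]
    [CompactSpace R] [T2Space R] [MeasurableSpace R] [BorelSpace R] (μ : Measure R)
    [μ.IsAddHaarMeasure] (ϖ : R) (M : ℕ) (F : R → ℂ) (a : R) :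
    ∫ τ in {τ | ϖ ^ M ∣ τ}, {t | ϖ ^ M ∣ t}.indicator F (a + τ) ∂μ =
      {t | ϖ ^ M ∣ t}.indicator (fun _ => ∫ t in {t | ϖ ^ M ∣ t}, F t ∂μ) a := by
  by_cases ha : ϖ ^ M ∣ a
  · rw [Set.indicator_of_mem (by exact ha), setIntegral_eq_integral_of_forall_compl_eq_zero,
      integral_add_left_eq_self, integral_indicator (isClosed_setOf_dvd _).measurableSet]
    intro τ hτ
    rw [Set.indicator_of_notMem]
    exact fun h => hτ ((dvd_add_right ha).mp h)
  · rw [Set.indicator_of_notMem (by exact ha)]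
    refine setIntegral_eq_zero_of_forall_eq_zero fun τ hτ => ?_
    rw [Set.indicator_of_notMem]
    exact fun h => ha ((dvd_add_left hτ).mp h)

variable [TopologicalSpace R] [IsTopologicalRing R] [CompactSpace R]
  [T2Space R] [IsDomain R] [IsDiscreteValuationRing R] [Finite (IsLocalRing.ResidueField R)]
  {ϖ : R} (hϖ : Irreducible ϖ) {χ : Rˣ →* ℂˣ} (hχ : Continuous χ)

include hϖ

lemma continuous_indicator_pow_dvd {F : R → ℂ} (hF : Continuous F) (M : ℕ) :
    Continuous ({t | ϖ ^ M ∣ t}.indicator F) :=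
  hF.indicator (by simp [(isClopen_setOf_pow_dvd hϖ M).frontier_eq])

include hχ in
-- The parameter `1 / 2` in `layer` is just a nonzero value at which the weight is continuous; the
-- factor `2 ^ k` cancels it.
lemma continuous_layer (k : ℕ) : Continuous (layer ϖ χ k) := by
  have h := ((isClopen_setOf_pow_dvd hϖ k).inter (isClopen_setOf_pow_dvd hϖ (k + 1)).compl)
  refine (continuous_const.mul (continuous_weight hϖ hχ (by norm_num))).indicator fun a ha => ?_
  have h2 := h.frontier_eq
  change a ∈ frontier ({t | ϖ ^ k ∣ t} ∩ {t | ϖ ^ (k + 1) ∣ t}ᶜ) at ha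
  simp [h2] at ha

variable [MeasurableSpace R] [BorelSpace R] (μ : Measure R) [μ.IsAddHaarMeasure]

variable [IsAdicComplete (IsLocalRing.maximalIdeal R) R]

/-- On a region where `b * y ^ m` is not too small, the values of `w + b * y ^ m` in `ϖ ^ M R` are
equidistributed. -/
lemma integral_mul_indicator_add_mul_pow {m : ℕ} (hm : IsUnit (m : R)) {b : R} (hb : b ≠ 0)
    (M : ℕ) (w : R) {Ψ : R → ℂ} (hΨ : Continuous Ψ) (hΨu : ∀ (u : Rˣ) y, Ψ (u * y) = Ψ y)
    (hΨs : ∀ y, Ψ y ≠ 0 → ϖ ^ M ∣ w + b * y ^ m → ¬ ϖ ^ M ∣ b * y ^ m) {F : R → ℂ}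
    (hF : Continuous F) :
    μ.real {t | ϖ ^ M ∣ t} * ∫ y, Ψ y * {t | ϖ ^ M ∣ t}.indicator F (w + b * y ^ m) ∂μ =
      (∫ y, Ψ y * {t | ϖ ^ M ∣ t}.indicator (fun _ => 1) (w + b * y ^ m) ∂μ) *
        ∫ t in {t | ϖ ^ M ∣ t}, F t ∂μ := by
  have := secondCountableTopology hϖ
  set E : Set R := {t | ϖ ^ M ∣ t} with hE
  set h : R → R := fun y => w + b * y ^ m with hh
  have hcont : Continuous h := by fun_prop
  have hG := continuous_indicator_pow_dvd hϖ hF M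
  have hEm : MeasurableSet E := (isClosed_setOf_dvd _).measurableSet
  -- The change of variable `T` preserves measure and `Ψ`, and realizes the translation by `τ`
  -- wherever the integrand can be nonzero.
  have hshift : ∀ τ ∈ E, ∫ y, Ψ y * E.indicator F (h y + τ) ∂μ =
      ∫ y, Ψ y * E.indicator F (h y) ∂μ := by
    intro τ hτ
    obtain ⟨T, hT1, hT2, hT3, hT4⟩ := exists_shift hϖ hm hb hτ
    have hΦ : Continuous fun y => Ψ y * E.indicator F (h y) := hΨ.mul (hG.comp hcont)
    rw [← integral_comp_of_associated_sub hϖ μ hT1 hΦ]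
    refine integral_congr_ae (.of_forall fun y => ?_)
    have h1 : Ψ (T y) = Ψ y := by
      obtain ⟨u, hu⟩ := hT2 y
      rw [hu, hΨu]
    simp only
    rw [h1]
    by_cases h0 : Ψ y = 0
    · simp [h0]
    by_cases hy : ϖ ^ M ∣ b * y ^ m
    · have h2 : ¬ ϖ ^ M ∣ h y := fun h3 => hΨs y h0 h3 hy
      have h3 : ¬ ϖ ^ M ∣ h y + τ := fun h4 => h2 ((dvd_add_left hτ).mp h4)
      rw [hT4 y hy, Set.indicator_of_notMem (by exact h3), Set.indicator_of_notMem (by exact h2)]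
    · have h2 : h (T y) = h y + τ := by simp only [hh, hT3 y hy]; ring
      rw [h2]
  have hint : Integrable (Function.uncurry fun τ y => Ψ y * E.indicator F (h y + τ))
      ((μ.restrict E).prod μ) := by
    refine integrable_of_continuous _ ?_
    exact (hΨ.comp continuous_snd).mul
      (hG.comp ((hcont.comp continuous_snd).add continuous_fst))
  -- Averaging over `τ ∈ E` and swapping the integrals replaces `F` by its integral over `E`.
  calc _ = ∫ τ in E, ∫ y, Ψ y * E.indicator F (h y + τ) ∂μ ∂μ := by
        rw [setIntegral_congr_fun hEm hshift, setIntegral_const, Complex.real_smul]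
    _ = ∫ y, ∫ τ in E, Ψ y * E.indicator F (h y + τ) ∂μ ∂μ := integral_integral_swap hint
    _ = _ := by
        rw [← integral_mul_const]
        refine integral_congr_ae (.of_forall fun y => ?_)
        simp only
        rw [integral_const_mul, setIntegral_indicator_pow_dvd_add μ ϖ, mul_assoc]
        by_cases hy : h y ∈ E
        · rw [Set.indicator_of_mem hy, Set.indicator_of_mem hy, one_mul]
        · rw [Set.indicator_of_notMem hy, Set.indicator_of_notMem hy, zero_mul]

include hχ

variable [IsProbabilityMeasure μ]

/-- This separates the dependence on `z`: valuations below `M` give coefficients free of `z`, and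
equidistribution reduces the tail to the integral of the weight itself. -/
lemma integral_mul_weight_add_mul_pow {m : ℕ} (hm : IsUnit (m : R)) {b : R} (hb : b ≠ 0)
    (M : ℕ) (w : R) {Ψ : R → ℂ} (hΨ : Continuous Ψ) (hΨu : ∀ (u : Rˣ) y, Ψ (u * y) = Ψ y)
    (hΨs : ∀ y, Ψ y ≠ 0 → ϖ ^ M ∣ w + b * y ^ m → ¬ ϖ ^ M ∣ b * y ^ m) {z : ℂ} (hz : ‖z‖ < 1) :
    ∫ y, Ψ y * weight ϖ χ z (w + b * y ^ m) ∂μ =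
      ∑ k ∈ Finset.range M, z ^ k * ∫ y, Ψ y * layer ϖ χ k (w + b * y ^ m) ∂μ +
      z ^ M * (∫ y, Ψ y * {t | ϖ ^ M ∣ t}.indicator (fun _ => 1) (w + b * y ^ m) ∂μ) *
        ∫ t, weight ϖ χ z t ∂μ := by
  have hW := continuous_weight hϖ hχ hz
  have hcont : Continuous fun y : R => w + b * y ^ m := by fun_prop
  have hq : ((Nat.card (IsLocalRing.ResidueField R) : ℂ)⁻¹) ^ M ≠ 0 := by
    have : Nat.card (IsLocalRing.ResidueField R) ≠ 0 := Nat.card_pos.ne'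
    positivity
  have hmain : ∫ y, Ψ y * {t | ϖ ^ M ∣ t}.indicator (weight ϖ χ z) (w + b * y ^ m) ∂μ =
      z ^ M * (∫ y, Ψ y * {t | ϖ ^ M ∣ t}.indicator (fun _ => 1) (w + b * y ^ m) ∂μ) *
        ∫ t, weight ϖ χ z t ∂μ := by
    have h := integral_mul_indicator_add_mul_pow hϖ μ hm hb M w hΨ hΨu hΨs hW
    rw [setIntegral_weight_pow_dvd hϖ, measureReal_pow_dvd hϖ] at h
    push_cast at h
    refine mul_left_cancel₀ hq (h.trans ?_)
    ring
  have hint : ∀ k ∈ Finset.range M,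
      Integrable (fun y => z ^ k * (Ψ y * layer ϖ χ k (w + b * y ^ m))) μ := fun k _ =>
    integrable_of_continuous μ
      (continuous_const.mul (hΨ.mul ((continuous_layer hϖ hχ k).comp hcont)))
  have hint' : Integrable (fun y => Ψ y * {t | ϖ ^ M ∣ t}.indicator (weight ϖ χ z)
      (w + b * y ^ m)) μ :=
    integrable_of_continuous μ (hΨ.mul ((continuous_indicator_pow_dvd hϖ hW M).comp hcont))
  rw [← hmain]
  simp_rw [← integral_const_mul]
  rw [← integral_finsetSum _ hint, ← integral_add (integrable_finsetSum _ hint) hint']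
  refine integral_congr_ae (.of_forall fun y => ?_)
  simp only
  rw [weight_eq_sum_layer_add hϖ χ z M, mul_add, Finset.mul_sum]
  congr 1
  exact Finset.sum_congr rfl fun k _ => by ring

lemma exists_polynomial_integral_add_mul_pow {m : ℕ} (hm : IsUnit (m : R)) {b : R} (hb : b ≠ 0)
    (M : ℕ) {w : R → R} (hw : Continuous w) {Ψ : R → R → ℂ}
    (hΨ : Continuous (Function.uncurry Ψ)) (hΨu : ∀ x (u : Rˣ) y, Ψ x (u * y) = Ψ x y)
    (hΨs : ∀ x y, Ψ x y ≠ 0 → ϖ ^ M ∣ w x + b * y ^ m → ¬ ϖ ^ M ∣ b * y ^ m) :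
    ∃ P : Polynomial ℂ, ∀ z : ℂ, ‖z‖ < 1 →
      ∫ x, ∫ y, Ψ x y * weight ϖ χ z (w x + b * y ^ m) ∂μ ∂μ =
        P.eval z / (1 - (Nat.card (IsLocalRing.ResidueField R) : ℂ)⁻¹ * z) := by
  have := secondCountableTopology hϖ
  have hcont : Continuous fun p : R × R => w p.1 + b * p.2 ^ m := by fun_prop
  have hint : ∀ F : R → ℂ, Continuous F →
      Integrable (fun x => ∫ y, Ψ x y * F (w x + b * y ^ m) ∂μ) μ := fun F hF =>
    (integrable_of_continuous (μ.prod μ) (hΨ.mul (hF.comp hcont))).integral_prod_left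
  set E : Set R := {t | ϖ ^ M ∣ t}
  set A : ℕ → ℂ := fun k => ∫ x, ∫ y, Ψ x y * layer ϖ χ k (w x + b * y ^ m) ∂μ ∂μ with hA
  set B : ℂ := ∫ x, ∫ y, Ψ x y * E.indicator (fun _ => 1) (w x + b * y ^ m) ∂μ ∂μ with hB
  set q := Nat.card (IsLocalRing.ResidueField R)
  refine ⟨(∑ k ∈ Finset.range M, Polynomial.C (A k) * Polynomial.X ^ k) *
    (1 - Polynomial.C (q : ℂ)⁻¹ * Polynomial.X) +
    Polynomial.C (B * ∫ t, weight ϖ χ 0 t ∂μ) * Polynomial.X ^ M, fun z hz => ?_⟩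
  have hsum : ∀ k ∈ Finset.range M, Integrable (fun x => z ^ k *
      ∫ y, Ψ x y * layer ϖ χ k (w x + b * y ^ m) ∂μ) μ := fun k _ =>
    (hint _ (continuous_layer hϖ hχ k)).const_mul _
  have hE : Integrable (fun x => z ^ M * (∫ y, Ψ x y * E.indicator (fun _ => 1)
      (w x + b * y ^ m) ∂μ) * ∫ t, weight ϖ χ z t ∂μ) μ :=
    ((hint _ (continuous_indicator_pow_dvd hϖ continuous_const M)).const_mul _).mul_const _
  have hx : ∀ x, ∫ y, Ψ x y * weight ϖ χ z (w x + b * y ^ m) ∂μ = _ := fun x =>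
    integral_mul_weight_add_mul_pow hϖ hχ μ hm hb M (w x) (Ψ := Ψ x)
      (hΨ.comp (Continuous.prodMk_right x)) (hΨu x) (hΨs x) hz
  simp_rw [hx]
  rw [integral_add (integrable_finsetSum _ hsum) hE, integral_finsetSum _ hsum,
    integral_mul_const, integral_const_mul]
  simp_rw [integral_const_mul]
  rw [integral_weight hϖ hχ μ hz, eq_div_iff (one_sub_natCast_inv_mul_ne_zero q hz), add_mul,
    mul_assoc (z ^ M * _), div_mul_cancel₀ _ (one_sub_natCast_inv_mul_ne_zero q hz)]
  simp only [Polynomial.eval_add, Polynomial.eval_mul, Polynomial.eval_finsetSum,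
    Polynomial.eval_C, Polynomial.eval_X, Polynomial.eval_pow, Polynomial.eval_sub,
    Polynomial.eval_one]
  simp only [mul_comm (A _)]
  ring

end Submersion

section Algebra

variable {R : Type*} [CommRing R] [IsDomain R] [IsDiscreteValuationRing R] {ϖ : R}
  (hϖ : Irreducible ϖ)

include hϖ

lemma weight_eq_of_dvd_sub_one {v : R} (hv : ϖ ∣ v - 1) (χ : Rˣ →* ℂˣ) (z w : ℂ) :
    weight ϖ χ z v = weight ϖ χ w v := by
  obtain ⟨u, rfl⟩ := isUnit_of_dvd_sub hϖ hv isUnit_one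
  rw [weight_unit hϖ, weight_unit hϖ]

/-- Where `(x, y)` is not in `ϖ ^ a R × ϖ ^ b R`, the summands of `μ₁ * x ^ d + μ₂ * y ^ m` cannot
both be small. -/
lemma exists_forall_not_pow_dvd {μ₁ μ₂ : R} (hμ₁ : IsUnit μ₁) (hμ₂ : μ₂ ≠ 0) {d m a b : ℕ}
    (hd : d ≠ 0) (hm : m ≠ 0) (hab : d * a = m * b) :
    ∃ M : ℕ, ∀ x y : R, ¬ (ϖ ^ a ∣ x ∧ ϖ ^ b ∣ y) → ϖ ^ M ∣ μ₁ * x ^ d + μ₂ * y ^ m →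
      ¬ ϖ ^ M ∣ μ₂ * y ^ m := by
  -- With `k` the valuation of `μ₂`, `M = k + d * a = k + m * b` makes divisibility of both terms
  -- force `ϖ ^ a ∣ x` and `ϖ ^ b ∣ y`.
  obtain ⟨k, u, rfl⟩ := IsDiscreteValuationRing.eq_unit_mul_pow_irreducible hμ₂ hϖ
  refine ⟨k + d * a, fun x y hxy h1 h2 => hxy ⟨?_, ?_⟩⟩
  · have h3 := (dvd_add_left h2).mp h1
    rw [hμ₁.dvd_mul_left] at h3
    rw [← IsIntegrallyClosed.pow_dvd_pow_iff hd, ← pow_mul, mul_comm a]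
    exact (pow_dvd_pow ϖ (Nat.le_add_left _ _)).trans h3
  · rw [mul_assoc, Units.dvd_mul_left, pow_add, mul_dvd_mul_iff_left (pow_ne_zero k hϖ.ne_zero),
      hab, mul_comm m, pow_mul] at h2
    exact (IsIntegrallyClosed.pow_dvd_pow_iff hm).mp h2

end Algebra

/-! ### Integrals of the weight along `μ₁ x ^ d + μ₂ y ^ m`. -/

section PlaneCurve

variable {R : Type*} [CommRing R] [TopologicalSpace R] [IsTopologicalRing R] [CompactSpace R]
  [T2Space R] [IsDomain R] [IsDiscreteValuationRing R] [Finite (IsLocalRing.ResidueField R)]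
  [MeasurableSpace R] [BorelSpace R] (μ : Measure R) [μ.IsAddHaarMeasure]
  {ϖ : R} (hϖ : Irreducible ϖ) {χ : Rˣ →* ℂˣ} (hχ : Continuous χ)

include hϖ

lemma integral_indicator_pow_dvd_mul [IsProbabilityMeasure μ] (n : ℕ) (F : R → ℂ) :
    ∫ x, {x | ϖ ^ n ∣ x}.indicator (fun _ => 1) x * F x ∂μ =
      ((Nat.card (IsLocalRing.ResidueField R) : ℂ)⁻¹) ^ n * ∫ x, F (ϖ ^ n * x) ∂μ := by
  have h : ∀ x, {x | ϖ ^ n ∣ x}.indicator (fun _ => (1 : ℂ)) x * F x =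
      {x | ϖ ^ n ∣ x}.indicator F x := fun x => by
    by_cases hx : ϖ ^ n ∣ x
    · rw [Set.indicator_of_mem (by exact hx), Set.indicator_of_mem (by exact hx), one_mul]
    · rw [Set.indicator_of_notMem (by exact hx), Set.indicator_of_notMem (by exact hx), zero_mul]
  simp_rw [h]
  rw [integral_indicator (isClosed_setOf_dvd _).measurableSet,
    setIntegral_dvd (pow_ne_zero n hϖ.ne_zero), measureReal_pow_dvd hϖ]
  push_cast
  rfl

/-- The perturbing factor has a `d`-th root `ρ x`, and `x ↦ x * ρ x` preserves measure because `ϖ *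
(x - y)` divides `ρ x - ρ y`. -/
lemma integral_comp_mul_pow_add [IsAdicComplete (IsLocalRing.maximalIdeal R) R] {d : ℕ}
    (hd : IsUnit (d : R)) (e : Polynomial R) (a w : R)
    {F : R → ℂ} (hF : Continuous F) :
    ∫ x, F (a * x ^ d * (1 + ϖ * (x * e.eval x)) + w) ∂μ = ∫ x, F (a * x ^ d + w) ∂μ := by
  have hρ : ∀ x : R, ∃ ρ : R, ϖ ∣ ρ - 1 ∧ ρ ^ d = 1 + ϖ * (x * e.eval x) := fun x =>
    exists_pow_eq_of_dvd_sub_one hϖ hd (by simp)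
  choose ρ hρ1 hρ2 using hρ
  have hG : Continuous fun x : R => F (a * x ^ d + w) := hF.comp (by fun_prop)
  rw [← integral_comp_of_associated_sub hϖ μ (φ := fun x => x * ρ x) ?_ hG]
  · refine integral_congr_ae (.of_forall fun x => ?_)
    simp only
    rw [← hρ2, mul_pow, mul_assoc]
  · intro x y
    have h1 := associated_pow_sub_pow hϖ hd (hρ1 x) (hρ1 y)
    rw [hρ2, hρ2] at h1
    obtain ⟨c, hc⟩ := Polynomial.sub_dvd_eval_sub x y (Polynomial.X * e)
    simp only [Polynomial.eval_mul, Polynomial.eval_X] at hc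
    have h2 : ϖ * (x - y) ∣ ρ x - ρ y :=
      h1.dvd_iff_dvd_right.mp ⟨c, by linear_combination ϖ * hc⟩
    obtain ⟨f, hf⟩ := h2
    have h3 : ϖ ∣ (ρ x + ϖ * (y * f)) - 1 := by
      rw [add_sub_right_comm]
      exact dvd_add (hρ1 x) (dvd_mul_right _ _)
    obtain ⟨u, hu⟩ := isUnit_of_dvd_sub hϖ h3 isUnit_one
    refine Associated.symm ⟨u, ?_⟩
    rw [hu]
    linear_combination -y * hf

include hχ

/-- For fixed `y` the argument has difference quotient `μ₁ + ϖ * c` in `x`, a unit, so it preserves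
Haar measure. -/
lemma integral_weight_linear [IsProbabilityMeasure μ] {μ₁ : R} (hμ₁ : IsUnit μ₁)
    (h₀ : Polynomial R) {w : R → R}
    (hw : Continuous w) {z : ℂ} (hz : ‖z‖ < 1) :
    ∫ x, ∫ y, weight ϖ χ z (μ₁ * x + w y + ϖ * h₀.eval x) ∂μ ∂μ = ∫ t, weight ϖ χ z t ∂μ := by
  have := secondCountableTopology hϖ
  have hW := continuous_weight hϖ hχ hz
  have hint : Integrable (Function.uncurry fun x y =>
      weight ϖ χ z (μ₁ * x + w y + ϖ * h₀.eval x)) (μ.prod μ) := by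
    refine integrable_of_continuous _ (hW.comp ?_)
    have := h₀.continuous
    fun_prop
  rw [integral_integral_swap hint]
  have h : ∀ y, ∫ x, weight ϖ χ z (μ₁ * x + w y + ϖ * h₀.eval x) ∂μ =
      ∫ t, weight ϖ χ z t ∂μ := fun y => by
    refine integral_comp_of_associated_sub hϖ μ
      (φ := fun x => μ₁ * x + w y + ϖ * h₀.eval x) (fun x x' => ?_) hW
    obtain ⟨c, hc⟩ := Polynomial.sub_dvd_eval_sub x x' h₀
    obtain ⟨u, hu⟩ := isUnit_of_dvd_sub hϖ (a := μ₁ + ϖ * c) (by simp) hμ₁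
    refine Associated.symm ⟨u, ?_⟩
    rw [hu]
    linear_combination -ϖ * hc
  simp [h]

variable [IsAdicComplete (IsLocalRing.maximalIdeal R) R]

/-- Write `v = u ^ m` and replace `y` by `u * y`: then `v` is a common factor of the argument. The
parameter `0` is harmless since `v` is a unit. -/
lemma integral_weight_mul_add_mul_pow {m : ℕ} (hm : IsUnit (m : R)) {z : ℂ} (hz : ‖z‖ < 1)
    {v : R} (hv : ϖ ∣ v - 1) (a b : R) :
    ∫ y, weight ϖ χ z (a * v + b * y ^ m) ∂μ =
      weight ϖ χ 0 v * ∫ y, weight ϖ χ z (a + b * y ^ m) ∂μ := by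
  have hW := continuous_weight hϖ hχ hz
  obtain ⟨ρ, hρ, rfl⟩ := exists_pow_eq_of_dvd_sub_one hϖ hm hv
  obtain ⟨u, rfl⟩ := isUnit_of_dvd_sub hϖ hρ isUnit_one
  have hF : Continuous fun y : R => weight ϖ χ z (a * u ^ m + b * y ^ m) :=
    hW.comp (by fun_prop)
  rw [← integral_comp_of_associated_sub hϖ μ (φ := fun y => u * y) (fun x y => by
    rw [← mul_sub]; exact (associated_unit_mul_left _ _ u.isUnit)) hF, ← integral_const_mul]
  refine integral_congr_ae (.of_forall fun y => ?_)
  simp only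
  rw [weight_eq_of_dvd_sub_one hϖ hv χ 0 z, ← weight_mul hϖ]
  congr 1
  ring

lemma exists_polynomial_integral_mul_weight [IsProbabilityMeasure μ] {μ₁ μ₂ : R}
    (hμ₁ : IsUnit μ₁) (hμ₂ : μ₂ ≠ 0)
    {d m a b : ℕ} (hd : d ≠ 0) (hm : IsUnit (m : R)) (ha : a ≠ 0) (hab : d * a = m * b) (c : ℕ)
    {ψ : R → ℂ} (hψ : Continuous ψ) (hψ1 : ∀ x, ϖ ^ c ∣ x → ψ x = 1) :
    ∃ P : Polynomial ℂ, ∀ z : ℂ, ‖z‖ < 1 →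
      ∫ x, ∫ y, ψ x * weight ϖ χ z (μ₁ * x ^ d + μ₂ * y ^ m) ∂μ ∂μ =
        P.eval z / ((1 - (Nat.card (IsLocalRing.ResidueField R) : ℂ)⁻¹ * z) *
          (1 - ((Nat.card (IsLocalRing.ResidueField R) : ℂ)⁻¹) ^ (a + b) * z ^ (d * a))) := by
  have := secondCountableTopology hϖ
  have hm0 : m ≠ 0 := by rintro rfl; simp at hm
  set q := Nat.card (IsLocalRing.ResidueField R)
  set I : ℕ → R → ℂ := fun n => {x | ϖ ^ n ∣ x}.indicator fun _ => 1 with hI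
  have hIc : ∀ n, Continuous (I n) := fun n => continuous_indicator_pow_dvd hϖ continuous_const n
  obtain ⟨M, hM⟩ := exists_forall_not_pow_dvd hϖ hμ₁ hμ₂ hd hm0 hab
  have hden1 : ∀ z : ℂ, ‖z‖ < 1 → 1 - (q : ℂ)⁻¹ * z ≠ 0 := fun z hz =>
    one_sub_natCast_inv_mul_ne_zero q hz
  have hden2 : ∀ z : ℂ, ‖z‖ < 1 → 1 - (q : ℂ)⁻¹ ^ (a + b) * z ^ (d * a) ≠ 0 := fun z hz => by
    have h := one_sub_natCast_inv_mul_ne_zero (q ^ (a + b)) (z := z ^ (d * a)) (by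
      rw [norm_pow]; exact pow_lt_one₀ (norm_nonneg _) hz (mul_ne_zero hd ha))
    rwa [Nat.cast_pow, ← inv_pow] at h
  -- Cutting out the box `ϖ ^ a R × ϖ ^ b R`: its complement has only the pole `1 - z / q`, and the
  -- box rescales to the same integral with `ψ` dilated.
  have hrec : ∀ ψ : R → ℂ, Continuous ψ → ∃ P : Polynomial ℂ, ∀ z : ℂ, ‖z‖ < 1 →
      ∫ x, ∫ y, ψ x * weight ϖ χ z (μ₁ * x ^ d + μ₂ * y ^ m) ∂μ ∂μ =
        P.eval z / (1 - (q : ℂ)⁻¹ * z) + (q : ℂ)⁻¹ ^ (a + b) * z ^ (d * a) *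
          ∫ x, ∫ y, ψ (ϖ ^ a * x) * weight ϖ χ z (μ₁ * x ^ d + μ₂ * y ^ m) ∂μ ∂μ := by
    intro ψ hψ
    obtain ⟨P, hP⟩ := exists_polynomial_integral_add_mul_pow hϖ hχ μ hm hμ₂ M
      (w := fun x => μ₁ * x ^ d) (by fun_prop) (Ψ := fun x y => ψ x * (1 - I a x * I b y))
      (by
        have h1 := hIc a
        have h2 := hIc b
        simp only [Function.uncurry_def]
        fun_prop)
      (fun x u y => by
        have h : I b (u * y) = I b y := by
          by_cases hy : ϖ ^ b ∣ y
          · rw [hI]; simp only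
            rw [Set.indicator_of_mem (by exact hy.mul_left _), Set.indicator_of_mem (by exact hy)]
          · rw [hI]; simp only
            rw [Set.indicator_of_notMem (by exact fun h => hy (Units.dvd_mul_left.mp h)),
              Set.indicator_of_notMem (by exact hy)]
        rw [h])
      (fun x y hxy => hM x y fun ⟨h1, h2⟩ => hxy (by
        simp only [hI]
        rw [Set.indicator_of_mem (by exact h1), Set.indicator_of_mem (by exact h2)]
        simp))
    refine ⟨P, fun z hz => ?_⟩
    have hW := continuous_weight hϖ hχ hz
    rw [← hP z hz]
    set G : R → R → ℂ := fun x y => weight ϖ χ z (μ₁ * x ^ d + μ₂ * y ^ m) with hG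
    have hGc : Continuous (Function.uncurry G) := hW.comp (by fun_prop)
    have hint : ∀ f : R × R → ℂ, Continuous f →
        Integrable (fun x => ∫ y, f (x, y) ∂μ) μ ∧ ∀ x, Integrable (fun y => f (x, y)) μ :=
      fun f hf => ⟨(integrable_of_continuous (μ.prod μ) hf).integral_prod_left,
        fun x => integrable_of_continuous μ (hf.comp (Continuous.prodMk_right x))⟩
    have hc1 : Continuous fun p : R × R => ψ p.1 * (1 - I a p.1 * I b p.2) * G p.1 p.2 := by
      have h1 := hIc a
      have h2 := hIc b
      have h3 : Continuous fun p : R × R => G p.1 p.2 := hGc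
      fun_prop
    have hc2 : Continuous fun p : R × R => I a p.1 * (I b p.2 * (ψ p.1 * G p.1 p.2)) := by
      have h1 := hIc a
      have h2 := hIc b
      have h3 : Continuous fun p : R × R => G p.1 p.2 := hGc
      fun_prop
    have hsplit : ∫ x, ∫ y, ψ x * G x y ∂μ ∂μ =
        ∫ x, ∫ y, ψ x * (1 - I a x * I b y) * G x y ∂μ ∂μ +
          ∫ x, ∫ y, I a x * (I b y * (ψ x * G x y)) ∂μ ∂μ := by
      rw [← integral_add (hint _ hc1).1 (hint _ hc2).1]
      refine integral_congr_ae (.of_forall fun x => ?_)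
      simp only
      rw [← integral_add ((hint _ hc1).2 x) ((hint _ hc2).2 x)]
      refine integral_congr_ae (.of_forall fun y => ?_)
      simp only
      ring
    have hscale : ∫ x, ∫ y, I a x * (I b y * (ψ x * G x y)) ∂μ ∂μ =
        (q : ℂ)⁻¹ ^ (a + b) * z ^ (d * a) * ∫ x, ∫ y, ψ (ϖ ^ a * x) * G x y ∂μ ∂μ := by
      have h : ∀ x y, ψ (ϖ ^ a * x) * G (ϖ ^ a * x) (ϖ ^ b * y) =
          z ^ (d * a) * (ψ (ϖ ^ a * x) * G x y) := fun x y => by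
        have h1 : μ₁ * (ϖ ^ a * x) ^ d + μ₂ * (ϖ ^ b * y) ^ m =
            ϖ ^ (d * a) * (μ₁ * x ^ d + μ₂ * y ^ m) := by
          rw [mul_pow, mul_pow, ← pow_mul, ← pow_mul, mul_comm a, mul_comm b, ← hab]
          ring
        simp only [hG]
        rw [h1, weight_pow_mul hϖ]
        ring
      simp_rw [integral_const_mul, hI, integral_indicator_pow_dvd_mul μ hϖ, h, integral_const_mul]
      ring
    rw [hsplit, hscale]
  have hbase : ∀ ψ : R → ℂ, Continuous ψ → ∀ P : Polynomial ℂ, (∀ z : ℂ, ‖z‖ < 1 →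
      ∫ x, ∫ y, ψ (ϖ ^ a * x) * weight ϖ χ z (μ₁ * x ^ d + μ₂ * y ^ m) ∂μ ∂μ =
        P.eval z / ((1 - (q : ℂ)⁻¹ * z) * (1 - (q : ℂ)⁻¹ ^ (a + b) * z ^ (d * a)))) →
      ∃ P : Polynomial ℂ, ∀ z : ℂ, ‖z‖ < 1 →
        ∫ x, ∫ y, ψ x * weight ϖ χ z (μ₁ * x ^ d + μ₂ * y ^ m) ∂μ ∂μ =
          P.eval z / ((1 - (q : ℂ)⁻¹ * z) * (1 - (q : ℂ)⁻¹ ^ (a + b) * z ^ (d * a))) := by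
    intro ψ hψ P hP
    obtain ⟨P', hP'⟩ := hrec ψ hψ
    refine ⟨P' * (1 - Polynomial.C ((q : ℂ)⁻¹ ^ (a + b)) * Polynomial.X ^ (d * a)) +
      Polynomial.C ((q : ℂ)⁻¹ ^ (a + b)) * Polynomial.X ^ (d * a) * P, fun z hz => ?_⟩
    have h1 := hden1 z hz
    have h2 := hden2 z hz
    rw [hP' z hz, hP z hz]
    simp only [Polynomial.eval_add, Polynomial.eval_mul, Polynomial.eval_sub, Polynomial.eval_one,
      Polynomial.eval_C, Polynomial.eval_X, Polynomial.eval_pow]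
    generalize (q : ℂ)⁻¹ ^ (a + b) * z ^ (d * a) = Q at *
    generalize 1 - (q : ℂ)⁻¹ * z = r at *
    field_simp
  -- Each dilation by `ϖ ^ a`, with `a ≥ 1`, lowers `c` by one. At `c = 0` the function is `1`, so
  -- the recursion is a linear equation in a single integral.
  induction c generalizing ψ with
  | zero =>
    obtain ⟨P, hP⟩ := hrec ψ hψ
    refine ⟨P, fun z hz => ?_⟩
    have h := hP z hz
    have hψ2 : ∀ x, ψ x = 1 := fun x => hψ1 x (by simp)
    simp only [hψ2] at h ⊢
    have h1 := hden1 z hz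
    have h2 := hden2 z hz
    rw [eq_div_iff (mul_ne_zero h1 h2)]
    rw [← sub_eq_iff_eq_add, eq_div_iff h1] at h
    linear_combination h
  | succ c ih =>
    obtain ⟨P, hP⟩ := ih (ψ := fun x => ψ (ϖ ^ a * x)) (by fun_prop) (fun x hx => hψ1 _ (by
      rw [add_comm c, pow_add]
      exact mul_dvd_mul (pow_dvd_pow ϖ (Nat.one_le_iff_ne_zero.mpr ha)) hx))
    exact hbase ψ hψ P hP

end PlaneCurve

/-! ### The polynomials over the ring of integers. -/

section ValuativeRel

variable {K : Type*} [Field K] [ValuativeRel K]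

lemma isUnit_natCast_of_not_dvd {p : ℕ} (hp : p.Prime) [CharP K p] {n : ℕ} (hn : ¬ p ∣ n) :
    IsUnit (n : 𝒪[K]) := by
  have : CharP 𝒪[K] p := (algebraMap 𝒪[K] K).charP Subtype.val_injective p
  have h := Nat.isCoprime_iff_coprime.mpr ((hp.coprime_iff_not_dvd.mpr hn))
  obtain ⟨a, b, hab⟩ := h
  refine IsUnit.of_mul_eq_one ((b : ℤ) : 𝒪[K]) ?_
  have h1 := congrArg (Int.cast : ℤ → 𝒪[K]) hab
  push_cast at h1
  rw [CharP.cast_eq_zero, mul_zero, zero_add] at h1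
  rw [mul_comm]
  exact h1

lemma eval_hPoly (ϖ μ₁ μ₂ : 𝒪[K]) (d m : ℕ) (h₀ : Polynomial 𝒪[K]) (x y : 𝒪[K]) :
    MvPolynomial.eval ![x, y] (hPoly ϖ μ₁ μ₂ d m h₀) =
      μ₁ * x ^ d + μ₂ * y ^ m + ϖ * h₀.eval x := by
  have h : MvPolynomial.eval ![x, y]
      (Polynomial.aeval (MvPolynomial.X 0 : MvPolynomial (Fin 2) 𝒪[K]) h₀) = h₀.eval x := by
    rw [Polynomial.aeval_def, Polynomial.hom_eval₂]
    have h1 : (MvPolynomial.eval ![x, y]).comp (algebraMap 𝒪[K] (MvPolynomial (Fin 2) 𝒪[K])) =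
        RingHom.id _ := by
      ext a
      simp [MvPolynomial.algebraMap_eq]
    rw [h1]
    simp [Polynomial.eval₂_id]
  simp [hPoly, h]

lemma eval_h₁Poly (μ₁ μ₂ : 𝒪[K]) (d m : ℕ) (x y : 𝒪[K]) :
    MvPolynomial.eval ![x, y] (h₁Poly μ₁ μ₂ d m) = μ₁ * x ^ d + μ₂ * y ^ m := by
  simp [h₁Poly]

/-- The factor `X ^ (d + 1)` of `h₀` lets the perturbation be absorbed into `μ₁ * x ^ d`; the spare
`x` makes the resulting unit tend to `1` at `x = 0`. -/
lemma exists_eval_hPoly_eq (ϖ : 𝒪[K]) {μ₁ : 𝒪[K]} (hμ₁ : IsUnit μ₁) (μ₂ : 𝒪[K]) (d m : ℕ)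
    {h₀ : Polynomial 𝒪[K]} (hh₀ : ((d + 1 : ℕ) : ℕ∞) ≤ h₀.trailingDegree) :
    ∃ e : Polynomial 𝒪[K], ∀ x y, MvPolynomial.eval ![x, y] (hPoly ϖ μ₁ μ₂ d m h₀) =
      μ₁ * x ^ d * (1 + ϖ * (x * e.eval x)) + μ₂ * y ^ m := by
  obtain ⟨g, rfl⟩ : Polynomial.X ^ (d + 1) ∣ h₀ := Polynomial.X_pow_dvd_iff.mpr fun k hk =>
    Polynomial.coeff_eq_zero_of_lt_trailingDegree (lt_of_lt_of_le (by exact_mod_cast hk) hh₀)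
  obtain ⟨u, rfl⟩ := hμ₁
  refine ⟨Polynomial.C (u⁻¹ : 𝒪[K]ˣ).1 * g, fun x y => ?_⟩
  rw [eval_hPoly]
  simp only [Polynomial.eval_mul, Polynomial.eval_pow, Polynomial.eval_X, Polynomial.eval_C]
  linear_combination -(ϖ * x ^ (d + 1) * g.eval x) * u.mul_inv

end ValuativeRel

/-! ### Passage from the zeta function to the iterated integral of the weight. -/

section LocalField

variable {K : Type*} [Field K] [ValuativeRel K] [TopologicalSpace K]
  [IsNonarchimedeanLocalField K]

instance : T2Space 𝒪[K] := by
  let := IsTopologicalAddGroup.rightUniformSpace K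
  have := isUniformAddGroup_of_addCommGroup (G := K)
  have : T0Space K := ValuedRing.separated
  infer_instance

instance : IsAdicComplete (IsLocalRing.maximalIdeal 𝒪[K]) 𝒪[K] := by
  let := IsTopologicalAddGroup.rightUniformSpace K
  have := isUniformAddGroup_of_addCommGroup (G := K)
  infer_instance

lemma one_lt_residueCard : 1 < residueCard K := Finite.one_lt_card

lemma norm_residueCard_cpow_neg_lt_one {s : ℂ} (hs : 0 < s.re) :
    ‖(residueCard K : ℂ) ^ (-s)‖ < 1 := by
  have hq := one_lt_residueCard (K := K)
  rw [Complex.norm_natCast_cpow_of_pos (by omega)]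
  exact Real.rpow_lt_one_of_one_lt_of_neg (by exact_mod_cast hq) (by simpa using hs)

lemma ofUnitHom_angularComponent_mul_absVal_cpow {ϖ : 𝒪[K]} (hϖ : Irreducible ϖ)
    (χ : 𝒪[K]ˣ →* ℂˣ) {s : ℂ} (hs : s ≠ 0) (t : 𝒪[K]) :
    MulChar.ofUnitHom χ (angularComponent ϖ t) * (absVal t : ℂ) ^ s =
      weight ϖ χ ((residueCard K : ℂ) ^ (-s)) t := by
  rcases eq_or_ne t 0 with rfl | ht
  · rw [weight_zero hϖ, absVal, if_pos rfl, Complex.ofReal_zero, Complex.zero_cpow hs, mul_zero]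
  · obtain ⟨k, u, rfl⟩ := IsDiscreteValuationRing.eq_unit_mul_pow_irreducible ht hϖ
    have h : ∃ v : 𝒪[K]ˣ, ∃ n : ℕ, (u * ϖ ^ k : 𝒪[K]) = v * ϖ ^ n := ⟨u, k, rfl⟩
    obtain ⟨n, hn⟩ := h.choose_spec
    have h1 := IsDiscreteValuationRing.unit_mul_pow_congr_unit hϖ u _ k _ hn
    have h2 : angularComponent ϖ (u * ϖ ^ k) = u := by
      rw [angularComponent, dif_pos h, ← h1]
    have h3 : absVal (u * ϖ ^ k : 𝒪[K]) = ((residueCard K : ℝ)⁻¹) ^ k := by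
      rw [absVal, if_neg ht, IsDiscreteValuationRing.addVal_def _ u hϖ k rfl]
      rfl
    have h4 : (((residueCard K : ℂ))⁻¹) ^ s = (residueCard K : ℂ) ^ (-s) := by
      rw [Complex.inv_cpow _ _ (by rw [Complex.natCast_arg]; exact Real.pi_pos.ne),
        Complex.cpow_neg]
    have h5 : ∀ k : ℕ, (((((residueCard K : ℝ)⁻¹) ^ k : ℝ)) : ℂ) ^ s =
        ((residueCard K : ℂ) ^ (-s)) ^ k := by
      intro k
      induction k with
      | zero => simp
      | succ k ih =>
        rw [pow_succ, Complex.ofReal_mul, Complex.mul_cpow_ofReal_nonneg (by positivity)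
          (by positivity), ih, pow_succ]
        congr 1
        push_cast
        exact h4
    rw [h2, h3, h5, MulChar.ofUnitHom_coe, weight_unit_mul_pow hϖ]

variable [MeasurableSpace K] [BorelSpace K]

instance : (integerHaar K).IsAddHaarMeasure := by
  unfold integerHaar; infer_instance

instance : IsProbabilityMeasure (integerHaar K) :=
  ⟨Measure.addHaarMeasure_self⟩

lemma zeta_eq_integral_weight {ϖ : 𝒪[K]} (hϖ : Irreducible ϖ) {χ : 𝒪[K]ˣ →* ℂˣ}
    (hχ : Continuous χ) (f : MvPolynomial (Fin 2) 𝒪[K]) {s : ℂ} (hs : 0 < s.re) :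
    zeta ϖ χ f s = ∫ x, ∫ y, weight ϖ χ ((residueCard K : ℂ) ^ (-s))
      (MvPolynomial.eval ![x, y] f) ∂integerHaar K ∂integerHaar K := by
  have := secondCountableTopology hϖ
  have hs0 : s ≠ 0 := by rintro rfl; simp at hs
  have hcont : Continuous fun p : 𝒪[K] × 𝒪[K] => weight ϖ χ ((residueCard K : ℂ) ^ (-s))
      (MvPolynomial.eval ![p.1, p.2] f) := by
    refine (continuous_weight hϖ hχ (norm_residueCard_cpow_neg_lt_one hs)).comp
      ((MvPolynomial.continuous_eval f).comp (continuous_pi fun i => ?_))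
    fin_cases i
    · exact continuous_fst
    · exact continuous_snd
  rw [← integral_prod _ (integrable_of_continuous _ hcont),
    ← (measurePreserving_finTwoArrow (integerHaar K)).integral_comp', zeta]
  refine integral_congr_ae (.of_forall fun x => ?_)
  simp only
  rw [ofUnitHom_angularComponent_mul_absVal_cpow hϖ χ hs0]
  have hx : ![(MeasurableEquiv.finTwoArrow x).1, (MeasurableEquiv.finTwoArrow x).2] = x := by
    funext i
    fin_cases i <;> rfl
  rw [hx]

end LocalField

end IgusaZeta

theorem theorem1p1
    {K : Type*} [Field K] [ValuativeRel K] [TopologicalSpace K] [IsNonarchimedeanLocalField K]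
    [MeasurableSpace K] [BorelSpace K]
    (p : ℕ) (hp : p.Prime) [CharP K p]
    (ϖ : 𝒪[K]) (hϖ : Irreducible ϖ)
    (χ : 𝒪[K]ˣ →* ℂˣ) (hχ : Continuous χ)
    (d m : ℕ) (hm : 2 ≤ m) (hpm : ¬ p ∣ m)
    (μ₁ μ₂ : 𝒪[K]) (hμ₁ : IsUnit μ₁) (hμ₂ : μ₂ ≠ 0)
    (h₀ : Polynomial 𝒪[K]) (hh₀ : ((d + 1 : ℕ) : ℕ∞) ≤ h₀.trailingDegree) :
    (d ≤ 1 → ∃ H₁ : Polynomial ℂ, ∀ s : ℂ, 0 < s.re →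
      IgusaZeta.zeta ϖ χ (IgusaZeta.hPoly ϖ μ₁ μ₂ d m h₀) s =
        H₁.eval ((IgusaZeta.residueCard K : ℂ) ^ (-s)) /
          (1 - (IgusaZeta.residueCard K : ℂ) ^ (-1 - s))) ∧
    (2 ≤ d → ∃ H₂ : Polynomial ℂ, ∀ s : ℂ, 0 < s.re →
      IgusaZeta.zeta ϖ χ (IgusaZeta.hPoly ϖ μ₁ μ₂ d m h₀) s =
        H₂.eval ((IgusaZeta.residueCard K : ℂ) ^ (-s)) /
          ((1 - (IgusaZeta.residueCard K : ℂ) ^ (-1 - s)) *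
            (1 - (IgusaZeta.residueCard K : ℂ) ^
              (-((d / d.gcd m : ℕ) : ℂ) - ((m / d.gcd m : ℕ) : ℂ) -
                ((d / d.gcd m : ℕ) : ℂ) * ((m / d.gcd m : ℕ) : ℂ) * ((d.gcd m : ℕ) : ℂ) * s)))) ∧
    (2 ≤ d → (¬ p ∣ d ∨ ∀ u : 𝒪[K]ˣ, (u : 𝒪[K]) - 1 ∈ 𝓂[K] → χ u = 1) →
      ∀ s : ℂ, 0 < s.re →
        IgusaZeta.zeta ϖ χ (IgusaZeta.hPoly ϖ μ₁ μ₂ d m h₀) s =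
          IgusaZeta.zeta ϖ χ (IgusaZeta.h₁Poly μ₁ μ₂ d m) s) := by
  open IgusaZeta in
  have := secondCountableTopology hϖ
  have hmu : IsUnit (m : 𝒪[K]) := isUnit_natCast_of_not_dvd hp hpm
  have hq0 : (residueCard K : ℂ) ≠ 0 :=
    Nat.cast_ne_zero.mpr (by have := one_lt_residueCard (K := K); omega)
  have hden : ∀ s : ℂ, (residueCard K : ℂ) ^ (-1 - s) =
      (residueCard K : ℂ)⁻¹ * (residueCard K : ℂ) ^ (-s) := fun s => by
    rw [sub_eq_add_neg, Complex.cpow_add _ _ hq0, Complex.cpow_neg_one]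
  obtain ⟨e, he⟩ := exists_eval_hPoly_eq ϖ hμ₁ μ₂ d m hh₀
  set v : 𝒪[K] → 𝒪[K] := fun x => 1 + ϖ * (x * e.eval x) with hv
  have hv1 : ∀ x, ϖ ∣ v x - 1 := fun x => by simp [hv]
  have hvc : Continuous v := by have := e.continuous; fun_prop
  have hψ : Continuous fun x => weight ϖ χ 0 (v x) :=
    (continuous_weight hϖ hχ (by simp)).comp hvc
  have hreduce : ∀ s : ℂ, 0 < s.re → zeta ϖ χ (hPoly ϖ μ₁ μ₂ d m h₀) s =
      ∫ x, ∫ y, weight ϖ χ 0 (v x) * weight ϖ χ ((residueCard K : ℂ) ^ (-s))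
        (μ₁ * x ^ d + μ₂ * y ^ m) ∂integerHaar K ∂integerHaar K := fun s hs => by
    rw [zeta_eq_integral_weight hϖ hχ _ hs]
    simp_rw [he, integral_const_mul]
    refine integral_congr_ae (.of_forall fun x => ?_)
    exact integral_weight_mul_add_mul_pow _ hϖ hχ hmu (norm_residueCard_cpow_neg_lt_one hs)
      (hv1 x) _ _
  refine ⟨fun hd => ?_, fun hd => ?_, fun hd hcase s hs => ?_⟩
  · rcases Nat.le_one_iff_eq_zero_or_eq_one.mp hd with rfl | rfl
    -- For `d = 0`, `M = 1` suffices: `ϖ` cannot divide both `μ₁ + μ₂ * y ^ m` and `μ₂ * y ^ m`, as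
    -- `μ₁` is a unit.
    · obtain ⟨P, hP⟩ := exists_polynomial_integral_add_mul_pow hϖ hχ (integerHaar K) hmu hμ₂ 1
        (w := fun _ => μ₁) continuous_const (Ψ := fun x _ => weight ϖ χ 0 (v x))
        (hψ.comp continuous_fst) (fun _ _ _ => rfl) (fun x y _ h1 h2 => by
          rw [pow_one] at h1 h2
          exact hϖ.not_isUnit (isUnit_of_dvd_unit ((dvd_add_left h2).mp h1) hμ₁))
      refine ⟨P, fun s hs => ?_⟩
      rw [hreduce s hs, hden]
      simp only [pow_zero, mul_one]
      exact hP _ (norm_residueCard_cpow_neg_lt_one hs)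
    · refine ⟨Polynomial.C (∫ t, weight ϖ χ 0 t ∂integerHaar K), fun s hs => ?_⟩
      have hz := norm_residueCard_cpow_neg_lt_one (K := K) hs
      rw [zeta_eq_integral_weight hϖ hχ _ hs]
      simp only [eval_hPoly, pow_one]
      rw [integral_weight_linear (integerHaar K) hϖ hχ hμ₁ h₀ (w := fun y => μ₂ * y ^ m)
        (by fun_prop) hz, integral_weight hϖ hχ _ hz, hden, Polynomial.eval_C]
      rfl
  · obtain ⟨c, hc⟩ := exists_conductor hϖ hχ
    have hdd : d / d.gcd m * d.gcd m = d := Nat.div_mul_cancel (Nat.gcd_dvd_left d m)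
    have hmm : m / d.gcd m * d.gcd m = m := Nat.div_mul_cancel (Nat.gcd_dvd_right d m)
    obtain ⟨P, hP⟩ := exists_polynomial_integral_mul_weight (integerHaar K) hϖ hχ hμ₁ hμ₂
      (d := d) (m := m) (a := m / d.gcd m) (b := d / d.gcd m) (by omega) hmu
      (by rintro h; rw [h] at hmm; omega) (by
        rw [← Nat.mul_div_assoc _ (Nat.gcd_dvd_right d m),
          ← Nat.mul_div_assoc _ (Nat.gcd_dvd_left d m), mul_comm]) c hψ (fun x hx => by
          obtain ⟨u, hu⟩ := isUnit_of_dvd_sub hϖ (hv1 x) isUnit_one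
          rw [← hu, weight_unit hϖ, hc u, Units.val_one]
          rw [hu, hv, add_sub_cancel_left]
          exact (hx.mul_right _).mul_left _)
    refine ⟨P, fun s hs => ?_⟩
    have hexp : (residueCard K : ℂ) ^ (-((d / d.gcd m : ℕ) : ℂ) - ((m / d.gcd m : ℕ) : ℂ) -
        ((d / d.gcd m : ℕ) : ℂ) * ((m / d.gcd m : ℕ) : ℂ) * ((d.gcd m : ℕ) : ℂ) * s) =
        ((residueCard K : ℂ)⁻¹) ^ (m / d.gcd m + d / d.gcd m) *
          ((residueCard K : ℂ) ^ (-s)) ^ (d * (m / d.gcd m)) := by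
      rw [← Complex.cpow_neg_one, ← Complex.cpow_nat_mul, ← Complex.cpow_nat_mul,
        ← Complex.cpow_add _ _ hq0]
      congr 1
      have h1 := congrArg (Nat.cast : ℕ → ℂ) hdd
      rw [Nat.cast_mul] at h1
      rw [Nat.cast_mul, Nat.cast_add, ← h1]
      ring
    rw [hreduce s hs, hden, hexp]
    exact hP _ (norm_residueCard_cpow_neg_lt_one hs)
  · have hz := norm_residueCard_cpow_neg_lt_one (K := K) hs
    rw [zeta_eq_integral_weight hϖ hχ (h₁Poly μ₁ μ₂ d m) hs]
    simp_rw [eval_h₁Poly]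
    rcases hcase with hpd | htriv
    · have hW := continuous_weight hϖ hχ hz
      rw [zeta_eq_integral_weight hϖ hχ _ hs]
      simp_rw [he]
      -- The substitution absorbing `v` acts on `x` for fixed `y`, so `x` must be the inner
      -- variable.
      have hswap : ∀ w : 𝒪[K] → 𝒪[K], Continuous w →
          ∫ x, ∫ y, weight ϖ χ ((residueCard K : ℂ) ^ (-s)) (μ₁ * x ^ d * w x + μ₂ * y ^ m)
            ∂integerHaar K ∂integerHaar K =
          ∫ y, ∫ x, weight ϖ χ ((residueCard K : ℂ) ^ (-s)) (μ₁ * x ^ d * w x + μ₂ * y ^ m)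
            ∂integerHaar K ∂integerHaar K := fun w hw =>
        integral_integral_swap (integrable_of_continuous _
          (hW.comp (g := weight ϖ χ ((residueCard K : ℂ) ^ (-s)))
            (f := fun a : 𝒪[K] × 𝒪[K] => μ₁ * a.1 ^ d * w a.1 + μ₂ * a.2 ^ m) (by fun_prop)))
      have hswap1 := hswap (fun _ => 1) continuous_const
      simp only [mul_one] at hswap1
      rw [hswap v hvc, hswap1]
      refine integral_congr_ae (.of_forall fun y => ?_)
      exact integral_comp_mul_pow_add _ hϖ (isUnit_natCast_of_not_dvd hp hpd) e μ₁ (μ₂ * y ^ m) hW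
    · rw [hreduce s hs]
      have h1 : ∀ x, weight ϖ χ 0 (v x) = 1 := fun x => by
        obtain ⟨u, hu⟩ := isUnit_of_dvd_sub hϖ (hv1 x) isUnit_one
        rw [← hu, weight_unit hϖ, htriv u, Units.val_one]
        rw [hu, hϖ.maximalIdeal_eq, Ideal.mem_span_singleton]
        exact hv1 x
      simp only [h1, one_mul]
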